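/- Let $L_2=\mathbb Z_2\wr\mathbb Z$ be the lamplighter group, realised as the set $\mathbb Z\times\mathbb Z_2[z^{\pm1}]$ with the product $(\delta_1,f_1)(\delta_2,f_2)=(\delta_1+\delta_2,\ f_1z^{-\delta_2}+f_2)$ and generated by $a=(0,1)$ and $t=(1,0)$. For a group word $w=w(a,t,x)$, let $|w|$ be its length and $\sigma_x(w)$ the sum of the exponents of $x$ in $w$. The equation $w(a,t,x)=1$ over $L_2$ is called solvable if there is $s\in F(a,t)$ with $w(a,t,s)=1$ in $L_2$. Write $w=c_0x^{\varepsilon_1}c_1\cdots x^{\varepsilon_k}c_k$ with $\varepsilon_i=\pm1$ and constants $c_i=(\delta_i,f_i)\in L_2$, and put $t_w=\sum_{i=0}^k\delta_i$, $x_w=\sum_{i=1}^k\varepsilon_i$, $\alpha_i=\delta_{i+1}+\dots+\delta_k$, $\beta_i=\varepsilon_{i+1}+\dots+\varepsilon_k$, and $\gamma_i=\beta_i$ if $\varepsilon_i=1$, $\gamma_i=\beta_i-1$ if $\varepsilon_i=-1$. For $\delta\in\mathbb Z$ let $$\mathrm{num}_\delta(w)=\sum_{i=0}^k f_i\,z^{-\alpha_i-\beta_i\delta},\qquad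 \mathrm{den}_\delta(w)=\sum_{i=1}^k z^{-\alpha_{i-1}-\gamma_i\delta}\qquad\text{in }\mathbb Z_2[z^{\pm1}].$$ (1) There is an algorithm that, given a word $w$ with $\sigma_x(w)\ne0$, decides whether the equation $w(a,t,x)=1$ is solvable over $L_2$ in $O(|w|^2\log|w|\,\log\log|w|)$ time. The model of computation is a random-access machine whose registers store integers and whose instructions (addition, subtraction, multiplication, integer division, loading of constants, moves, indirect loads and stores, conditional and unconditional jumps, halt) take one step each. The input is given as $|w|$ and the letters of $w$, one letter per register, and the bit length of all integers that occur in the registers is bounded by a polynomial in $|w|$. (2) Let $\sigma_x(w)\ne0$. Then $x_w=\sigma_x(w)$, and every solution of $w(a,t,x)=1$ has the form $x=(\delta,f)$ in $L_2$ with $\delta=-t_w/x_w$. The equation is solvable if and only if $\delta=-t_w/x_w$ is an integer and $\mathrm{den}_\delta(w)$ divides $\mathrm{num}_\delta(w)$ in $\mathbb Z_2[z^{\pm1}]$ (where $0$ divides only $0$). -/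

import Mathlib

open scoped LaurentPolynomial

/-! ### The lamplighter group -/

/-- The ring of Laurent polynomials in one variable over the field of two elements. -/
abbrev BinLaurent : Type := LaurentPolynomial (ZMod 2)

/-- The lamplighter group: pairs of a position and a finitely supported configuration of lamps,
the configuration being written as a Laurent polynomial over the field of two elements. -/
@[ext]
structure Lamplighter where
  pos : ℤ
  lamps : BinLaurent

namespace Lamplighter

/-- The product is `(δ₁, f₁) (δ₂, f₂) = (δ₁ + δ₂, f₁ z ^ (-δ₂) + f₂)`. -/
noncomputable instance : Mul Lamplighter :=
  ⟨fun g h => ⟨g.pos + h.pos, g.lamps * LaurentPolynomial.T (-h.pos) + h.lamps⟩⟩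

noncomputable instance : One Lamplighter := ⟨⟨0, 0⟩⟩

noncomputable instance : Inv Lamplighter :=
  ⟨fun g => ⟨-g.pos, -(g.lamps * LaurentPolynomial.T g.pos)⟩⟩

@[simp] theorem pos_one : (1 : Lamplighter).pos = 0 := rfl

@[simp] theorem lamps_one : (1 : Lamplighter).lamps = 0 := rfl

@[simp] theorem pos_mul (g h : Lamplighter) : (g * h).pos = g.pos + h.pos := rfl

@[simp] theorem lamps_mul (g h : Lamplighter) :
    (g * h).lamps = g.lamps * LaurentPolynomial.T (-h.pos) + h.lamps := rfl

@[simp] theorem pos_inv (g : Lamplighter) : (g⁻¹).pos = -g.pos := rfl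

@[simp] theorem lamps_inv (g : Lamplighter) :
    (g⁻¹).lamps = -(g.lamps * LaurentPolynomial.T g.pos) := rfl

noncomputable instance : Group Lamplighter :=
  Group.ofLeftAxioms
    (by
      intro g h k
      ext1
      · simp [add_assoc]
      · simp only [lamps_mul, pos_mul, neg_add, LaurentPolynomial.T_add]
        ring)
    (by
      intro g
      ext1
      · simp
      · simp)
    (by
      intro g
      ext1
      · simp
      · simp only [lamps_mul, lamps_inv, lamps_one, neg_mul, mul_assoc,
          ← LaurentPolynomial.T_add]
        simp)

/-- The generator `a`: the lamp at the origin is switched. -/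
noncomputable def genA : Lamplighter := ⟨0, 1⟩

/-- The generator `t`: the lamplighter moves by one. -/
noncomputable def genT : Lamplighter := ⟨1, 0⟩

end Lamplighter

/-! ### One-variable equations -/

/-- The letters that may occur in a constant. -/
inductive ConstGen where
  | a
  | t

/-- The letters that may occur in a one-variable equation; `x` is the unknown. -/
inductive EqGen where
  | a
  | t
  | x

/-- Group words in `a`, `t`, `x`, reduced or not. The pair `(g, true)` stands for the letter `g`
and `(g, false)` for its inverse, as in `FreeGroup.mk`. -/
abbrev EqWord : Type := List (EqGen × Bool)

namespace EqWord

/-- The value in the lamplighter group of an element of the free group `F(a, t)`. -/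
noncomputable def constValue : FreeGroup ConstGen →* Lamplighter :=
  FreeGroup.lift fun
    | ConstGen.a => Lamplighter.genA
    | ConstGen.t => Lamplighter.genT

/-- The value in the lamplighter group of `w(a, t, g)`. -/
noncomputable def subst (w : EqWord) (g : Lamplighter) : Lamplighter :=
  FreeGroup.lift (fun
    | EqGen.a => Lamplighter.genA
    | EqGen.t => Lamplighter.genT
    | EqGen.x => g) (FreeGroup.mk w)

/-- The element `s` of `F(a, t)` is a solution of `w(a, t, x) = 1`. -/
def IsSolution (w : EqWord) (s : FreeGroup ConstGen) : Prop :=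
  w.subst (constValue s) = 1

/-- The equation `w(a, t, x) = 1` has a solution. -/
def Solvable (w : EqWord) : Prop :=
  ∃ s : FreeGroup ConstGen, w.IsSolution s

/-- The exponent `1` or `-1` of a letter. -/
def expo (b : Bool) : ℤ := if b then 1 else -1

/-- `σ_x(w)`: the sum of the exponents of `x` in `w`. -/
def sigmaX : EqWord → ℤ
  | [] => 0
  | (EqGen.x, b) :: w => expo b + sigmaX w
  | (_, _) :: w => sigmaX w

/-- The form `c₀ x ^ ε₁ c₁ ⋯ x ^ ε_k c_k` of a word, with constants `c_i` in the lamplighter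
group and exponents `ε_i = ±1`, stored as `(c₀, [(ε₁, c₁), …, (ε_k, c_k)])`. -/
noncomputable def normalForm : EqWord → Lamplighter × List (ℤ × Lamplighter)
  | [] => (1, [])
  | (EqGen.a, b) :: w => (Lamplighter.genA ^ expo b * (normalForm w).1, (normalForm w).2)
  | (EqGen.t, b) :: w => (Lamplighter.genT ^ expo b * (normalForm w).1, (normalForm w).2)
  | (EqGen.x, b) :: w => (1, (expo b, (normalForm w).1) :: (normalForm w).2)

/-- For the tail `[(ε_{i+1}, c_{i+1}), …, (ε_k, c_k)]` of a normal form, where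
`c_j = (δ_j, f_j)`: the number `α_i = δ_{i+1} + ⋯ + δ_k`. -/
def alpha (l : List (ℤ × Lamplighter)) : ℤ := (l.map fun p => p.2.pos).sum

/-- For the tail `[(ε_{i+1}, c_{i+1}), …, (ε_k, c_k)]` of a normal form: the number
`β_i = ε_{i+1} + ⋯ + ε_k`. -/
def beta (l : List (ℤ × Lamplighter)) : ℤ := (l.map fun p => p.1).sum

/-- The sum of `f_i z ^ (-α_i - β_i δ)` over the constants `c_i = (δ_i, f_i)` of
`c, (ε_{i+1}, c_{i+1}), …, (ε_k, c_k)`. -/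
noncomputable def numForm (δ : ℤ) : Lamplighter → List (ℤ × Lamplighter) → BinLaurent
  | c, [] => c.lamps
  | c, (e, c') :: l =>
      c.lamps * LaurentPolynomial.T (-alpha ((e, c') :: l) - beta ((e, c') :: l) * δ)
        + numForm δ c' l

/-- The sum of `z ^ (-α_{i-1} - γ_i δ)` over the entries `(ε_i, c_i)`, where `γ_i = β_i` if
`ε_i = 1` and `γ_i = β_i - 1` if `ε_i = -1`. -/
noncomputable def denForm (δ : ℤ) : List (ℤ × Lamplighter) → BinLaurent
  | [] => 0
  | (e, c) :: l =>
      LaurentPolynomial.T (-alpha ((e, c) :: l) - (if e = 1 then beta l else beta l - 1) * δ)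
        + denForm δ l

/-- `t_w = δ₀ + ⋯ + δ_k`. -/
noncomputable def tw (w : EqWord) : ℤ := w.normalForm.1.pos + alpha w.normalForm.2

/-- `x_w = ε₁ + ⋯ + ε_k`. -/
noncomputable def xw (w : EqWord) : ℤ := beta w.normalForm.2

/-- `num_δ(w)`. -/
noncomputable def num (w : EqWord) (δ : ℤ) : BinLaurent :=
  numForm δ w.normalForm.1 w.normalForm.2

/-- `den_δ(w)`. -/
noncomputable def den (w : EqWord) (δ : ℤ) : BinLaurent := denForm δ w.normalForm.2

/-- The integer that encodes a letter: `a, t, x` are `1, 2, 3` and an inverse letter is the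
negative of that. -/
def letterCode : EqGen × Bool → ℤ
  | (EqGen.a, b) => expo b
  | (EqGen.t, b) => 2 * expo b
  | (EqGen.x, b) => 3 * expo b

/-- The initial memory on input `w`: the length of `w` in register `0`, the codes of its letters
in registers `1, …, |w|`, and `0` everywhere else. -/
def inputMemory (w : EqWord) : ℤ → ℤ := fun i =>
  if i = 0 then (w.length : ℤ)
  else if 1 ≤ i then (w.map letterCode).getD (i - 1).toNat 0
  else 0

end EqWord

/-! ### Random-access machines -/

namespace RandomAccess

/-- The instructions; `M` is the memory. Division is integer division, with value `0` if the
divisor is `0`. -/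
inductive Instr where
  /-- `M[d] := c` -/
  | const (d c : ℤ)
  /-- `M[d] := M[r]` -/
  | copy (d r : ℤ)
  /-- `M[d] := M[r] + M[s]` -/
  | add (d r s : ℤ)
  /-- `M[d] := M[r] - M[s]` -/
  | sub (d r s : ℤ)
  /-- `M[d] := M[r] * M[s]` -/
  | mul (d r s : ℤ)
  /-- `M[d] := M[r] / M[s]` -/
  | div (d r s : ℤ)
  /-- `M[d] := M[M[r]]` -/
  | load (d r : ℤ)
  /-- `M[M[d]] := M[r]` -/
  | store (d r : ℤ)
  /-- Go to instruction `l`. -/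
  | jump (l : ℕ)
  /-- Go to instruction `l` if `M[r] = 0`. -/
  | jumpZero (r : ℤ) (l : ℕ)
  /-- Go to instruction `l` if `M[r] < 0`. -/
  | jumpNeg (r : ℤ) (l : ℕ)
  /-- Halt. -/
  | halt

/-- A program is a finite list of instructions, numbered from `0`. -/
abbrev Program : Type := List Instr

/-- The number of the current instruction and the contents of the registers, each of which
stores an integer. -/
structure Config where
  pc : ℕ
  mem : ℤ → ℤ

/-- Execution of a single instruction. -/
def Instr.exec (c : Config) : Instr → Config
  | .const d k => ⟨c.pc + 1, Function.update c.mem d k⟩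
  | .copy d r => ⟨c.pc + 1, Function.update c.mem d (c.mem r)⟩
  | .add d r s => ⟨c.pc + 1, Function.update c.mem d (c.mem r + c.mem s)⟩
  | .sub d r s => ⟨c.pc + 1, Function.update c.mem d (c.mem r - c.mem s)⟩
  | .mul d r s => ⟨c.pc + 1, Function.update c.mem d (c.mem r * c.mem s)⟩
  | .div d r s => ⟨c.pc + 1, Function.update c.mem d (c.mem r / c.mem s)⟩
  | .load d r => ⟨c.pc + 1, Function.update c.mem d (c.mem (c.mem r))⟩
  | .store d r => ⟨c.pc + 1, Function.update c.mem (c.mem d) (c.mem r)⟩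
  | .jump l => ⟨l, c.mem⟩
  | .jumpZero r l => ⟨if c.mem r = 0 then l else c.pc + 1, c.mem⟩
  | .jumpNeg r l => ⟨if c.mem r < 0 then l else c.pc + 1, c.mem⟩
  | .halt => c

/-- The machine has halted: it is at a `halt` instruction or outside of the program. -/
def Halted (P : Program) (c : Config) : Prop :=
  P[c.pc]? = none ∨ P[c.pc]? = some Instr.halt

/-- One computation step; a machine that has halted stays as it is. -/
def step (P : Program) (c : Config) : Config :=
  match P[c.pc]? with
  | none => c
  | some i => i.exec c

/-- The configuration after `k` steps, from instruction `0` and the memory `m`. -/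
def run (P : Program) (m : ℤ → ℤ) (k : ℕ) : Config := (step P)^[k] ⟨0, m⟩

/-- Started with memory `m`, the program `P` halts after at most `N` steps, with `v` in
register `0`. -/
def HaltsWithin (P : Program) (m : ℤ → ℤ) (N : ℕ) (v : ℤ) : Prop :=
  ∃ k ≤ N, Halted P (run P m k) ∧ (run P m k).mem 0 = v

end RandomAccess

open LaurentPolynomial (T)

/-! ### Evaluation of words in the lamplighter group -/

/-! Multiplying by a letter on the left adds its lamps, shifted by the position of the rest of the
word. Hence `w(a, t, (δ, f))` has position `t_w + x_w δ` and lamps `num_δ + f * den_δ`, signs being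
irrelevant in characteristic two (`subst_mk`). Every element of the group is the value of a word in
`a, t`, so solvability means that some integer `δ` has `t_w + x_w δ = 0` and `den_δ ∣ num_δ`; if
`x_w ≠ 0`, only `δ = -t_w / x_w` is possible.

For the algorithm, let `n = |w|`. Then `|δ| ≤ n`, all exponents of `z` lie in `[-n², n²]`, and
multiplication by the unit `z ^ (n²)` turns `num_δ` and `den_δ` into polynomials with at most `2n² +
1` coefficients. These are lifted to natural coefficients, which are never reduced modulo two, and
each polynomial is stored in one register as its value at `B = 6n³`. As long as all coefficients
stay below `B`, integer division by `B` is division by `X` with the constant term dropped; as `B` is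
even, the parity of the integer is the parity of the constant term (`eval_div`, `eval_mod_two`). A
coefficient step of long division therefore takes a constant number of instructions.

Division runs from the constant term upwards. Powers of `X` are removed from the divisor `p` until
its constant term is odd, or `p` is zero; this changes it by a unit of the Laurent ring
(`toLaurent_red_dvd_iff`). Then `q` is replaced by `(q + (q₀ mod 2) p) / X`, which preserves
divisibility by `p` modulo two since `p` is coprime to `X`. After `2n² + 1` steps the degree of `q`
modulo two is below that of `p`, so divisibility means that `q` vanishes modulo two
(`iterate_divStep_eq_zero_iff_dvd`). All loops together take `O(n²)` instructions, and the registers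
stay below a power of `B` with exponent `O(n²)`. -/

theorem BinLaurent.add_self (f : BinLaurent) : f + f = 0 := by
  have h : (2 : ZMod 2) = 0 := rfl
  have : (2 : BinLaurent) = 0 := by
    have := congrArg (LaurentPolynomial.C (R := ZMod 2)) h
    simpa only [map_ofNat, map_zero] using this
  rw [← two_mul, this, zero_mul]

theorem BinLaurent.neg_eq (f : BinLaurent) : -f = f :=
  neg_eq_of_add_eq_zero_left (BinLaurent.add_self f)

theorem BinLaurent.add_eq_zero_iff {f g : BinLaurent} : f + g = 0 ↔ f = g := by
  rw [add_eq_zero_iff_eq_neg, BinLaurent.neg_eq]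

namespace Lamplighter

theorem mk_mul (d e : ℤ) (f g : BinLaurent) :
    (⟨d, f⟩ * ⟨e, g⟩ : Lamplighter) = ⟨d + e, f * T (-e) + g⟩ := rfl

theorem mk_inv (d : ℤ) (f : BinLaurent) : (⟨d, f⟩ : Lamplighter)⁻¹ = ⟨-d, -(f * T d)⟩ := rfl

theorem genT_pow (k : ℕ) : genT ^ k = ⟨k, 0⟩ := by
  induction k with
  | zero => rfl
  | succ k ih => rw [pow_succ, ih, genT, mk_mul]; simp

theorem genT_zpow (k : ℤ) : genT ^ k = ⟨k, 0⟩ := by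
  cases k with
  | ofNat k => simpa using genT_pow k
  | negSucc k => rw [zpow_negSucc, genT_pow, mk_inv]; simp [Int.negSucc_eq]

theorem genA_inv : genA⁻¹ = genA := by
  rw [genA, mk_inv]; simp [BinLaurent.neg_eq]

end Lamplighter

namespace EqWord

open Lamplighter

/-- The conjugates `t ^ k * a * t ^ (-k)` are the single lamps `(0, z ^ k)`. They generate all
configurations at position `0`, and `t ^ d` then supplies the position. -/
theorem constValue_surjective : Function.Surjective constValue := by
  have ha : genA ∈ constValue.range :=
    ⟨FreeGroup.of ConstGen.a, by simp [constValue]⟩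
  have ht : genT ∈ constValue.range :=
    ⟨FreeGroup.of ConstGen.t, by simp [constValue]⟩
  have hT : ∀ k : ℤ, (⟨0, T k⟩ : Lamplighter) ∈ constValue.range := by
    intro k
    have h : (⟨0, T k⟩ : Lamplighter) = genT ^ k * genA * genT ^ (-k) := by
      rw [genT_zpow, genT_zpow, genA, mk_mul, mk_mul]; simp
    rw [h]
    exact mul_mem (mul_mem (zpow_mem ht _) ha) (zpow_mem ht _)
  have hadd : ∀ f g : BinLaurent, (⟨0, f⟩ : Lamplighter) ∈ constValue.range →
      (⟨0, g⟩ : Lamplighter) ∈ constValue.range →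
      (⟨0, f + g⟩ : Lamplighter) ∈ constValue.range := by
    intro f g hf hg
    have h : (⟨0, f + g⟩ : Lamplighter) = ⟨0, f⟩ * ⟨0, g⟩ := by rw [mk_mul]; simp
    rw [h]
    exact mul_mem hf hg
  have hlamps : ∀ f : BinLaurent, (⟨0, f⟩ : Lamplighter) ∈ constValue.range := by
    intro f
    induction f using LaurentPolynomial.induction_on' with
    | add f g hf hg => exact hadd f g hf hg
    | C_mul_T k c =>
      fin_cases c
      · change (⟨0, LaurentPolynomial.C 0 * T k⟩ : Lamplighter) ∈ _
        rw [map_zero, zero_mul]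
        exact one_mem _
      · change (⟨0, LaurentPolynomial.C 1 * T k⟩ : Lamplighter) ∈ _
        rw [map_one, one_mul]
        exact hT k
  rintro ⟨d, f⟩
  have h : (⟨d, f⟩ : Lamplighter) = genT ^ d * ⟨0, f⟩ := by rw [genT_zpow, mk_mul]; simp
  change _ ∈ constValue.range
  rw [h]
  exact mul_mem (zpow_mem ht _) (hlamps f)

theorem subst_nil (g : Lamplighter) : subst [] g = 1 := by
  simp [subst, ← FreeGroup.one_eq_mk]

theorem subst_cons (y : EqGen) (b : Bool) (w : EqWord) (g : Lamplighter) :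
    subst ((y, b) :: w) g = subst [(y, b)] g * subst w g := by
  simp only [subst, ← map_mul, FreeGroup.mul_mk, List.singleton_append]

theorem subst_a (b : Bool) (g : Lamplighter) : subst [(EqGen.a, b)] g = genA := by
  cases b <;> simp [subst, genA_inv]

theorem subst_t (b : Bool) (g : Lamplighter) : subst [(EqGen.t, b)] g = ⟨expo b, 0⟩ := by
  cases b <;> simp [subst, expo, genT, mk_inv]

theorem subst_x (g : Lamplighter) : subst [(EqGen.x, true)] g = g := by
  simp [subst]

theorem subst_x_inv (g : Lamplighter) : subst [(EqGen.x, false)] g = g⁻¹ := by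
  simp [subst]

theorem genA_zpow_expo (b : Bool) : genA ^ expo b = genA := by
  cases b <;> simp [expo, genA_inv]

@[simp] theorem alpha_nil : alpha [] = 0 := rfl

@[simp] theorem beta_nil : beta [] = 0 := rfl

@[simp] theorem alpha_cons (p : ℤ × Lamplighter) (l : List (ℤ × Lamplighter)) :
    alpha (p :: l) = p.2.pos + alpha l := by simp [alpha]

@[simp] theorem beta_cons (p : ℤ × Lamplighter) (l : List (ℤ × Lamplighter)) :
    beta (p :: l) = p.1 + beta l := by simp [beta]

/-- Isolates the lamps of the leading constant, the only part of `numForm` that changes when a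
letter `a` or `t` is put in front. -/
theorem numForm_eq (δ : ℤ) (c : Lamplighter) (l : List (ℤ × Lamplighter)) :
    numForm δ c l = c.lamps * T (-alpha l - beta l * δ) + numForm δ 1 l := by
  cases l <;> simp [numForm]

/-- The position of the lamplighter after `w(a, t, x)` if `x` moves it by `δ`. -/
def posAt (δ : ℤ) : EqWord → ℤ
  | [] => 0
  | (EqGen.a, _) :: w => posAt δ w
  | (EqGen.t, b) :: w => expo b + posAt δ w
  | (EqGen.x, b) :: w => expo b * δ + posAt δ w

theorem tw_add_xw_mul (δ : ℤ) (w : EqWord) : w.tw + w.xw * δ = posAt δ w := by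
  induction w with
  | nil => simp [tw, xw, normalForm, posAt]
  | cons y w ih =>
    rcases y with ⟨_ | _ | _, b⟩
    · simp only [tw, xw, normalForm, posAt, genA_zpow_expo, pos_mul] at ih ⊢
      rw [← ih, genA, zero_add]
    · simp only [tw, xw, normalForm, posAt, genT_zpow, pos_mul] at ih ⊢
      rw [← ih]; ring
    · simp only [tw, xw, normalForm, posAt, pos_one, alpha_cons, beta_cons] at ih ⊢
      rw [← ih]; ring

theorem xw_eq_sigmaX (w : EqWord) : w.xw = w.sigmaX := by
  induction w with
  | nil => simp [xw, normalForm, sigmaX]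
  | cons y w ih =>
    rcases y with ⟨_ | _ | _, b⟩ <;> simp only [xw, normalForm, sigmaX, beta_cons] at ih ⊢ <;>
      rw [ih]

theorem num_nil (δ : ℤ) : num [] δ = 0 := by simp [num, normalForm, numForm]

theorem den_nil (δ : ℤ) : den [] δ = 0 := by simp [den, normalForm, denForm]

theorem num_a (δ : ℤ) (b : Bool) (w : EqWord) :
    num ((EqGen.a, b) :: w) δ = num w δ + T (-posAt δ w) := by
  rw [num, num, normalForm, numForm_eq, numForm_eq δ w.normalForm.1, ← tw_add_xw_mul,
    genA_zpow_expo]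
  simp only [genA, lamps_mul, one_mul, add_mul, ← LaurentPolynomial.T_add, tw, xw]
  rw [show -w.normalForm.1.pos + (-alpha w.normalForm.2 - beta w.normalForm.2 * δ)
    = -(w.normalForm.1.pos + alpha w.normalForm.2 + beta w.normalForm.2 * δ) by ring]
  ring

theorem num_t (δ : ℤ) (b : Bool) (w : EqWord) : num ((EqGen.t, b) :: w) δ = num w δ := by
  rw [num, num, normalForm, numForm_eq, numForm_eq δ w.normalForm.1, genT_zpow]
  simp

theorem num_x (δ : ℤ) (b : Bool) (w : EqWord) : num ((EqGen.x, b) :: w) δ = num w δ := by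
  simp [num, normalForm, numForm]

theorem den_a (δ : ℤ) (b : Bool) (w : EqWord) : den ((EqGen.a, b) :: w) δ = den w δ := rfl

theorem den_t (δ : ℤ) (b : Bool) (w : EqWord) : den ((EqGen.t, b) :: w) δ = den w δ := rfl

theorem den_x (δ : ℤ) (b : Bool) (w : EqWord) :
    den ((EqGen.x, b) :: w) δ =
      den w δ + T (-posAt δ (if b then w else (EqGen.x, b) :: w)) := by
  -- For `x⁻¹` the relevant suffix includes the letter itself; this is the shift `γ_i = β_i - 1`.
  have h : posAt δ (if b then w else (EqGen.x, b) :: w)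
      = posAt δ w - if b then 0 else δ := by
    cases b
    · simp [posAt, expo, sub_eq_neg_add]
    · simp
  rw [h, den, den, normalForm, denForm, add_comm, ← tw_add_xw_mul, tw, xw]
  congr 2
  cases b
  · simp only [alpha_cons, expo]
    norm_num
    ring
  · simp only [alpha_cons, expo]
    norm_num
    ring

/-- By induction on the word: a letter in front contributes its lamps times `z` to minus the
position of the remaining suffix, as recorded by `num_a` and `den_x`. For `x⁻¹`, the factor `T δ` in
the inverse accounts for the different suffix in `den_x`. -/
theorem subst_mk (w : EqWord) (δ : ℤ) (f : BinLaurent) :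
    w.subst ⟨δ, f⟩ = ⟨posAt δ w, w.num δ + f * w.den δ⟩ := by
  induction w with
  | nil => rw [subst_nil, num_nil, den_nil]; ext1 <;> simp [posAt]
  | cons y w ih =>
    rcases y with ⟨_ | _ | _, b⟩
    · rw [subst_cons, ih, subst_a, num_a, den_a, genA, mk_mul]
      ext1
      · simp [posAt]
      · simp only; ring
    · rw [subst_cons, ih, subst_t, num_t, den_t, mk_mul]
      ext1
      · simp [posAt]
      · simp
    · cases b
      · rw [subst_cons, ih, subst_x_inv, num_x, den_x, mk_inv, mk_mul, BinLaurent.neg_eq]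
        ext1
        · simp [posAt, expo]
        · simp only [Bool.false_eq_true, if_false, posAt, expo, mul_assoc,
            ← LaurentPolynomial.T_add]
          rw [show -(-1 * δ + posAt δ w) = δ + -posAt δ w by ring]
          ring
      · rw [subst_cons, ih, subst_x, num_x, den_x, mk_mul]
        ext1
        · simp [posAt, expo]
        · simp only [if_true]; ring

theorem subst_mk_eq_one_iff (w : EqWord) (δ : ℤ) (f : BinLaurent) :
    w.subst ⟨δ, f⟩ = 1 ↔ w.tw + w.xw * δ = 0 ∧ w.num δ = f * w.den δ := by
  rw [subst_mk, Lamplighter.ext_iff, tw_add_xw_mul]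
  simp [BinLaurent.add_eq_zero_iff]

theorem solvable_iff (w : EqWord) :
    w.Solvable ↔ ∃ δ : ℤ, w.tw + w.xw * δ = 0 ∧ w.den δ ∣ w.num δ := by
  constructor
  · rintro ⟨s, hs⟩
    rw [IsSolution] at hs
    obtain ⟨h1, h2⟩ := (subst_mk_eq_one_iff w (constValue s).pos (constValue s).lamps).1 hs
    exact ⟨_, h1, Dvd.intro_left _ h2.symm⟩
  · rintro ⟨δ, h1, f, hf⟩
    obtain ⟨s, hs⟩ := constValue_surjective ⟨δ, f⟩
    refine ⟨s, ?_⟩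
    rw [IsSolution, hs, subst_mk_eq_one_iff, hf]
    exact ⟨h1, mul_comm _ _⟩

theorem eq_neg_tw_div_xw_iff {w : EqWord} (hw : w.xw ≠ 0) (δ : ℤ) :
    (δ : ℚ) = -(w.tw : ℚ) / (w.xw : ℚ) ↔ w.tw + w.xw * δ = 0 := by
  have h : (w.xw : ℚ) ≠ 0 := by exact_mod_cast hw
  rw [eq_div_iff h, eq_neg_iff_add_eq_zero, ← Int.cast_mul, ← Int.cast_add, Int.cast_eq_zero,
    add_comm, mul_comm]

theorem pos_of_isSolution {w : EqWord} (hw : w.xw ≠ 0) {s : FreeGroup ConstGen}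
    (hs : w.IsSolution s) : ((constValue s).pos : ℚ) = -(w.tw : ℚ) / (w.xw : ℚ) :=
  (eq_neg_tw_div_xw_iff hw _).2
    ((subst_mk_eq_one_iff w (constValue s).pos (constValue s).lamps).1 hs).1

end EqWord

/-! ### Structured programs -/

namespace RandomAccess

/-- The register and the value that an instruction writes; `none` for jumps and `halt`. -/
def Instr.assign (m : ℤ → ℤ) : Instr → Option (ℤ × ℤ)
  | .const d k => some (d, k)
  | .copy d r => some (d, m r)
  | .add d r s => some (d, m r + m s)
  | .sub d r s => some (d, m r - m s)
  | .mul d r s => some (d, m r * m s)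
  | .div d r s => some (d, m r / m s)
  | .load d r => some (d, m (m r))
  | .store d r => some (m d, m r)
  | _ => none

/-- The instructions of `b` are assignments, they write only values of size at most `K` when
executed in memory `m`, and the memory afterwards satisfies `Q`. -/
def BlockTo (K : ℤ) : List Instr → (ℤ → ℤ) → ((ℤ → ℤ) → Prop) → Prop
  | [], m, Q => Q m
  | i :: b, m, Q =>
    match i.assign m with
    | none => False
    | some (d, v) => |v| ≤ K ∧ BlockTo K b (Function.update m d v) Q

/-- All registers have size at most `K`. -/
def MemLE (K : ℤ) (m : ℤ → ℤ) : Prop := ∀ i, |m i| ≤ K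

/-- From `c` the program reaches `c'` in at most `N` steps and the registers have size at most
`K` on the way. -/
def Reaches (P : Program) (K : ℤ) (c c' : Config) (N : ℕ) : Prop :=
  ∃ k ≤ N, (step P)^[k] c = c' ∧ ∀ j ≤ k, MemLE K ((step P)^[j] c).mem

theorem MemLE.update {K : ℤ} {m : ℤ → ℤ} (hm : MemLE K m) (d : ℤ) {v : ℤ} (hv : |v| ≤ K) :
    MemLE K (Function.update m d v) := by
  intro i
  by_cases h : i = d
  · subst h; simpa using hv
  · simpa [h] using hm i

theorem Reaches.refl {P : Program} {K : ℤ} {c : Config} (hc : MemLE K c.mem) :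
    Reaches P K c c 0 :=
  ⟨0, le_rfl, rfl, fun j hj => by rw [Nat.le_zero.1 hj]; exact hc⟩

theorem Reaches.trans {P : Program} {K : ℤ} {c₁ c₂ c₃ : Config} {N N' : ℕ}
    (h : Reaches P K c₁ c₂ N) (h' : Reaches P K c₂ c₃ N') : Reaches P K c₁ c₃ (N + N') := by
  obtain ⟨k, hk, rfl, hb⟩ := h
  obtain ⟨k', hk', rfl, hb'⟩ := h'
  refine ⟨k + k', by omega, ?_, fun j hj => ?_⟩
  · rw [add_comm, Function.iterate_add_apply]
  · rcases le_total j k with h | h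
    · exact hb j h
    · obtain ⟨i, rfl⟩ := Nat.exists_eq_add_of_le h
      rw [add_comm, Function.iterate_add_apply]
      exact hb' i (by omega)

theorem Reaches.mono {P : Program} {K : ℤ} {c c' : Config} {N N' : ℕ}
    (h : Reaches P K c c' N) (hN : N ≤ N') : Reaches P K c c' N' := by
  obtain ⟨k, hk, h⟩ := h
  exact ⟨k, hk.trans hN, h⟩

theorem Reaches.of_step {P : Program} {K : ℤ} {c c' : Config} (h : step P c = c')
    (hc : MemLE K c.mem) (hc' : MemLE K c'.mem) : Reaches P K c c' 1 := by
  refine ⟨1, le_rfl, h, fun j hj => ?_⟩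
  interval_cases j
  · exact hc
  · simpa [h] using hc'

theorem Instr.exec_of_assign {i : Instr} {pc : ℕ} {m : ℤ → ℤ} {d v : ℤ}
    (h : i.assign m = some (d, v)) : i.exec ⟨pc, m⟩ = ⟨pc + 1, Function.update m d v⟩ := by
  cases i <;> simp_all [Instr.assign, Instr.exec]

/-- The program `P` has the code `b` at the instructions `o, o + 1, …`. -/
def CodeAt (P : Program) (o : ℕ) (b : List Instr) : Prop :=
  ∀ j < b.length, P[o + j]? = b[j]?

theorem CodeAt.head {P : Program} {o : ℕ} {i : Instr} {b : List Instr} (h : CodeAt P o (i :: b)) :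
    P[o]? = some i := by
  simpa using h 0 (by simp)

theorem CodeAt.left {P : Program} {o : ℕ} {b b' : List Instr} (h : CodeAt P o (b ++ b')) :
    CodeAt P o b := by
  intro j hj
  rw [h j (by simp; omega), List.getElem?_append_left hj]

theorem CodeAt.right {P : Program} {o : ℕ} {b b' : List Instr} (h : CodeAt P o (b ++ b')) :
    CodeAt P (o + b.length) b' := by
  intro j hj
  rw [add_assoc, h _ (by simp; omega), List.getElem?_append_right (by omega)]
  simp

theorem CodeAt.tail {P : Program} {o : ℕ} {i : Instr} {b : List Instr} (h : CodeAt P o (i :: b)) :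
    CodeAt P (o + 1) b :=
  CodeAt.right (b := [i]) h

theorem step_of_assign {P : Program} {o : ℕ} {i : Instr} {m : ℤ → ℤ} {d v : ℤ}
    (hi : P[o]? = some i) (h : i.assign m = some (d, v)) :
    step P ⟨o, m⟩ = ⟨o + 1, Function.update m d v⟩ := by
  simp only [step, hi]
  exact Instr.exec_of_assign h

/-- Soundness of symbolic execution: assignments never jump, so each costs one step and keeps the
size bound. -/
theorem BlockTo.reaches {P : Program} {K : ℤ} {b : List Instr} {Q : (ℤ → ℤ) → Prop} {o : ℕ}
    {m : ℤ → ℤ} (hP : CodeAt P o b) (hm : MemLE K m) (h : BlockTo K b m Q) :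
    ∃ m', Q m' ∧ MemLE K m' ∧ Reaches P K ⟨o, m⟩ ⟨o + b.length, m'⟩ b.length := by
  induction b generalizing o m with
  | nil => exact ⟨m, h, hm, Reaches.refl hm⟩
  | cons i b ih =>
    rw [BlockTo] at h
    split at h
    · exact h.elim
    · rename_i d v hi
      have hm' := hm.update d h.1
      obtain ⟨m', hQ, hb, hr⟩ := ih hP.tail hm' h.2
      refine ⟨m', hQ, hb, ?_⟩
      have := (Reaches.of_step (step_of_assign hP.head hi) hm hm').trans hr
      simpa [add_comm, add_left_comm] using this

/-- A straight-line piece of code, or a loop that repeats such a piece until a register is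
zero. -/
inductive Cmd where
  | block (b : List Instr)
  | loop (r : ℤ) (b : List Instr)

/-- The code of a command that is placed at instruction `o`. -/
def Cmd.code (o : ℕ) : Cmd → List Instr
  | .block b => b
  | .loop r b => Instr.jumpZero r (o + b.length + 2) :: (b ++ [Instr.jump o])

/-- The code of a sequence of commands that is placed at instruction `o`. -/
def compile (o : ℕ) : List Cmd → List Instr
  | [] => []
  | c :: l => c.code o ++ compile (o + (c.code o).length) l

/-- From memory `m` the commands `l` lead, in at most `N` steps and without writing a value of
size more than `K`, to a memory with property `Q`. -/
def Leads (K : ℤ) (l : List Cmd) (m : ℤ → ℤ) (Q : (ℤ → ℤ) → Prop) (N : ℕ) : Prop :=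
  ∀ (P : Program) (o : ℕ), CodeAt P o (compile o l) → MemLE K m →
    ∃ m', Q m' ∧ MemLE K m' ∧ Reaches P K ⟨o, m⟩ ⟨o + (compile o l).length, m'⟩ N

theorem Leads.nil {K : ℤ} {m : ℤ → ℤ} {Q : (ℤ → ℤ) → Prop} (h : Q m) : Leads K [] m Q 0 :=
  fun _ _ _ hm => ⟨m, h, hm, Reaches.refl hm⟩

theorem Leads.block {K : ℤ} {b : List Instr} {l : List Cmd} {m : ℤ → ℤ} {Q : (ℤ → ℤ) → Prop}
    {N : ℕ} (h : BlockTo K b m fun m' => Leads K l m' Q N) :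
    Leads K (.block b :: l) m Q (b.length + N) := by
  intro P o hP hm
  obtain ⟨m₁, hl, hm₁, hr₁⟩ := h.reaches hP.left hm
  obtain ⟨m', hQ, hm', hr⟩ := hl P _ hP.right hm₁
  refine ⟨m', hQ, hm', ?_⟩
  have := hr₁.trans hr
  simpa [compile, Cmd.code, add_assoc] using this

theorem BlockTo.mono {K : ℤ} {b : List Instr} {Q R : (ℤ → ℤ) → Prop} {m : ℤ → ℤ}
    (h : BlockTo K b m R) (hQ : ∀ m, R m → Q m) : BlockTo K b m Q := by
  induction b generalizing m with
  | nil => exact hQ m h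
  | cons i b ih =>
    rw [BlockTo] at h ⊢
    split
    · rename_i hi
      simp [hi] at h
    · rename_i d v hi
      simp only [hi] at h
      exact ⟨h.1, ih h.2⟩

theorem Leads.block_of {K : ℤ} {b : List Instr} {l : List Cmd} {m : ℤ → ℤ}
    {Q R : (ℤ → ℤ) → Prop} {N : ℕ} (h : BlockTo K b m R) (hl : ∀ m', R m' → Leads K l m' Q N) :
    Leads K (.block b :: l) m Q (b.length + N) :=
  Leads.block (h.mono hl)

/-- `I j` is the invariant with `j` iterations left. An iteration costs its body plus the test and
the jump back; the extra `1` is the test that exits. -/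
theorem Leads.loop {K : ℤ} {r : ℤ} {b : List Instr} {l : List Cmd} {m : ℤ → ℤ}
    {Q : (ℤ → ℤ) → Prop} {N : ℕ} (I : ℕ → (ℤ → ℤ) → Prop) (J : ℕ) (hI : I J m)
    (hr : ∀ j m, I j m → m r = j)
    (hstep : ∀ j < J, ∀ m, I (j + 1) m → BlockTo K b m (I j))
    (hl : ∀ m, I 0 m → Leads K l m Q N) :
    Leads K (.loop r b :: l) m Q (J * (b.length + 2) + 1 + N) := by
  intro P o hP hm
  have hlen : ((Cmd.loop r b).code o).length = b.length + 2 := by simp [Cmd.code]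
  have hc : CodeAt P o (Instr.jumpZero r (o + b.length + 2) :: (b ++ [Instr.jump o])) := hP.left
  have key : ∀ j ≤ J, ∀ m, I j m → MemLE K m → ∃ m', I 0 m' ∧ MemLE K m' ∧
      Reaches P K ⟨o, m⟩ ⟨o + b.length + 2, m'⟩ (j * (b.length + 2) + 1) := by
    intro j
    induction j with
    | zero =>
      intro _ m hI hm
      refine ⟨m, hI, hm, ?_⟩
      rw [Nat.zero_mul, Nat.zero_add]
      refine Reaches.of_step ?_ hm hm
      simp only [step, hc.head, Instr.exec]
      simp [hr 0 m hI]
    | succ j ih =>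
      intro hj m hI hm
      obtain ⟨m₁, hI₁, hm₁, hr₁⟩ := (hstep j hj m hI).reaches hc.tail.left hm
      obtain ⟨m', hI', hm', hr'⟩ := ih (by omega) m₁ hI₁ hm₁
      refine ⟨m', hI', hm', ?_⟩
      have h1 : Reaches P K ⟨o, m⟩ ⟨o + 1, m⟩ 1 := by
        refine Reaches.of_step ?_ hm hm
        simp only [step, hc.head, Instr.exec]
        rw [if_neg (by rw [hr _ _ hI]; exact_mod_cast Nat.succ_ne_zero j)]
      have h2 : Reaches P K ⟨o + 1 + b.length, m₁⟩ ⟨o, m₁⟩ 1 := by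
        refine Reaches.of_step ?_ hm₁ hm₁
        simp only [step, hc.tail.right.head, Instr.exec]
      exact (((h1.trans hr₁).trans h2).trans hr').mono (le_of_eq (by ring))
  obtain ⟨m₁, hI₁, hm₁, hr₁⟩ := key J le_rfl m hI hm
  have hP' := hP.right
  rw [hlen] at hP'
  obtain ⟨m', hQ, hm', hr'⟩ := hl m₁ hI₁ P _ hP' hm₁
  refine ⟨m', hQ, hm', ?_⟩
  have := hr₁.trans hr'
  simpa [compile, hlen, add_assoc] using this

theorem Leads.mono {K : ℤ} {l : List Cmd} {m : ℤ → ℤ} {Q : (ℤ → ℤ) → Prop} {N N' : ℕ}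
    (h : Leads K l m Q N) (hN : N ≤ N') : Leads K l m Q N' := by
  intro P o hP hm
  obtain ⟨m', hQ, hm', hr⟩ := h P o hP hm
  exact ⟨m', hQ, hm', hr.mono hN⟩

theorem step_of_halted {P : Program} {c : Config} (h : Halted P c) : step P c = c := by
  rcases h with h | h <;> simp [step, h, Instr.exec]

theorem Leads.haltsWithin {K : ℤ} {l : List Cmd} {m : ℤ → ℤ} {v : ℤ} {N : ℕ}
    (h : Leads K l m (fun m' => m' 0 = v) N) (hm : MemLE K m) :
    HaltsWithin (compile 0 l) m N v ∧ ∀ k, MemLE K (run (compile 0 l) m k).mem := by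
  obtain ⟨m', hv, hm', k, hk, hr, hb⟩ := h (compile 0 l) 0 (fun j _ => by rw [Nat.zero_add]) hm
  -- Control falls off the end of the code, which counts as halting; a halted configuration is
  -- fixed, so the size bound persists for all later steps.
  have hh : Halted (compile 0 l) ⟨0 + (compile 0 l).length, m'⟩ := by left; simp
  refine ⟨⟨k, hk, ?_, ?_⟩, fun j => ?_⟩
  · rw [run, hr]; exact hh
  · rw [run, hr]; exact hv
  · rcases le_total j k with h | h
    · exact hb j h
    · obtain ⟨i, rfl⟩ := Nat.exists_eq_add_of_le h
      rw [run, add_comm, Function.iterate_add_apply, hr,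
        Function.iterate_fixed (step_of_halted hh)]
      exact hm'

end RandomAccess

/-! ### Divisibility modulo two of polynomials with natural coefficients -/

namespace ParityPoly

open Polynomial

/-- Reduction of the coefficients modulo two. -/
noncomputable def red : ℕ[X] →+* (ZMod 2)[X] := mapRingHom (Nat.castRingHom (ZMod 2))

theorem coeff_red (p : ℕ[X]) (i : ℕ) : (red p).coeff i = (p.coeff i : ZMod 2) := by
  simp [red]

theorem red_X_pow (k : ℕ) : red (X ^ k) = X ^ k := by simp [red]

theorem red_eq_zero_iff {p : ℕ[X]} : red p = 0 ↔ ∀ i, p.coeff i % 2 = 0 := by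
  simp only [Polynomial.ext_iff, coeff_red, coeff_zero, ZMod.natCast_eq_zero_iff,
    Nat.dvd_iff_mod_eq_zero]

theorem red_divX (p : ℕ[X]) : red p.divX = (red p).divX := by
  ext i; simp [coeff_red, coeff_divX]

theorem eval_mod_two {B : ℕ} (hB : 2 ∣ B) (p : ℕ[X]) : p.eval B % 2 = p.coeff 0 % 2 := by
  conv_lhs => rw [← p.divX_mul_X_add, eval_add, eval_mul, eval_X, eval_C]
  obtain ⟨b, rfl⟩ := hB
  rw [mul_left_comm, Nat.mul_add_mod]

/-- The constant coefficient is the lowest digit in base `B`; the bound rules out a carry. -/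
theorem eval_div {B : ℕ} {p : ℕ[X]} (h : p.coeff 0 < B) : p.eval B / B = p.divX.eval B := by
  conv_lhs => rw [← p.divX_mul_X_add, eval_add, eval_mul, eval_X, eval_C]
  rw [mul_comm, Nat.mul_add_div (by omega), Nat.div_eq_of_lt h, add_zero]

theorem eval_lt {B : ℕ} {L : ℕ} {p : ℕ[X]} (h : ∀ i, p.coeff i < B)
    (hL : ∀ i, L ≤ i → p.coeff i = 0) : p.eval B < B ^ L := by
  induction L generalizing p with
  | zero =>
    have : p = 0 := by ext i; simpa using hL i (Nat.zero_le i)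
    simp [this]
  | succ L ih =>
    have h1 := ih (p := p.divX) (fun i => by rw [coeff_divX]; exact h _)
      (fun i hi => by rw [coeff_divX]; exact hL _ (by omega))
    rw [← p.divX_mul_X_add, eval_add, eval_mul, eval_X, eval_C, pow_succ]
    have := h 0
    nlinarith

/-- Divide by `X` if the constant coefficient is even. -/
noncomputable def normStep (p : ℕ[X]) : ℕ[X] := if p.coeff 0 % 2 = 0 then p.divX else p

theorem coeff_normStep_le {p : ℕ[X]} {K : ℕ} (h : ∀ i, p.coeff i ≤ K) (i : ℕ) :
    (normStep p).coeff i ≤ K := by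
  unfold normStep
  split
  · rw [coeff_divX]; exact h _
  · exact h _

theorem coeff_normStep_eq_zero {p : ℕ[X]} {L : ℕ} (h : ∀ i, L ≤ i → p.coeff i = 0) (i : ℕ)
    (hi : L ≤ i) : (normStep p).coeff i = 0 := by
  unfold normStep
  split
  · rw [coeff_divX]; exact h _ (by omega)
  · exact h _ hi

theorem coeff_iterate_normStep_le {p : ℕ[X]} {K : ℕ} (h : ∀ i, p.coeff i ≤ K) (k i : ℕ) :
    (normStep^[k] p).coeff i ≤ K := by
  induction k generalizing i with
  | zero => exact h i
  | succ k ih => rw [Function.iterate_succ_apply']; exact coeff_normStep_le ih i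

theorem coeff_iterate_normStep_eq_zero {p : ℕ[X]} {L : ℕ} (h : ∀ i, L ≤ i → p.coeff i = 0)
    (k i : ℕ) (hi : L ≤ i) : (normStep^[k] p).coeff i = 0 := by
  induction k generalizing i with
  | zero => exact h i hi
  | succ k ih => rw [Function.iterate_succ_apply']; exact coeff_normStep_eq_zero ih i hi

theorem red_normStep (p : ℕ[X]) : ∃ k, red p = X ^ k * red (normStep p) := by
  unfold normStep
  split
  · rename_i h
    refine ⟨1, ?_⟩
    conv_lhs => rw [← p.divX_mul_X_add]
    have : red (C (p.coeff 0)) = 0 := by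
      rw [red_eq_zero_iff]
      intro i
      rw [coeff_C]
      split <;> simp [h]
    rw [map_add, map_mul, this, add_zero, pow_one, ← pow_one (X : ℕ[X]), red_X_pow, pow_one,
      mul_comm]
  · exact ⟨0, by simp⟩

theorem red_iterate_normStep (p : ℕ[X]) (n : ℕ) : ∃ k, red p = X ^ k * red (normStep^[n] p) := by
  induction n with
  | zero => exact ⟨0, by simp⟩
  | succ n ih =>
    obtain ⟨k, hk⟩ := ih
    obtain ⟨l, hl⟩ := red_normStep (normStep^[n] p)
    refine ⟨k + l, ?_⟩
    rw [Function.iterate_succ_apply', hk, hl, pow_add, mul_assoc]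

/-- A polynomial with odd constant coefficient is a fixed point of `normStep`. If none is met, `n`
shifts use up all coefficients. -/
theorem iterate_normStep_eq_zero_or {p : ℕ[X]} {n : ℕ} (h : ∀ i, n ≤ i → p.coeff i = 0) :
    normStep^[n] p = 0 ∨ (normStep^[n] p).coeff 0 % 2 = 1 := by
  induction n generalizing p with
  | zero => left; ext i; simpa using h i (Nat.zero_le i)
  | succ n ih =>
    rw [Function.iterate_succ_apply]
    by_cases h0 : p.coeff 0 % 2 = 0
    · rw [normStep, if_pos h0]
      exact ih fun i hi => by rw [coeff_divX]; exact h _ (by omega)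
    · have hfix : normStep p = p := by rw [normStep, if_neg h0]
      rw [hfix, Function.iterate_fixed hfix]
      right; omega

/-- A division step by `p`, starting from the constant coefficient: add `p` if this makes the
constant coefficient even, add to the counter the parity of the new constant coefficient, and
divide by `X`. -/
noncomputable def divStep (p : ℕ[X]) (s : ℕ[X] × ℕ) : ℕ[X] × ℕ :=
  ((s.1 + C (s.1.coeff 0 % 2) * p).divX, s.2 + (s.1 + C (s.1.coeff 0 % 2) * p).coeff 0 % 2)

theorem coeff_add_mul_le {p q : ℕ[X]} {K K' : ℕ} (hq : ∀ i, q.coeff i ≤ K)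
    (hp : ∀ i, p.coeff i ≤ K') (i : ℕ) : (q + C (q.coeff 0 % 2) * p).coeff i ≤ K + K' := by
  rw [coeff_add, coeff_C_mul]
  have h2 : q.coeff 0 % 2 ≤ 1 := by omega
  have := Nat.mul_le_mul h2 (hp i)
  have := hq i
  omega

theorem coeff_add_mul_eq_zero {p q : ℕ[X]} {L : ℕ} (hq : ∀ i, L ≤ i → q.coeff i = 0)
    (hp : ∀ i, L ≤ i → p.coeff i = 0) (i : ℕ) (hi : L ≤ i) :
    (q + C (q.coeff 0 % 2) * p).coeff i = 0 := by
  rw [coeff_add, coeff_C_mul, hq i hi, hp i hi, mul_zero, add_zero]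

theorem coeff_iterate_divStep_le {p q : ℕ[X]} {K K' : ℕ} (hq : ∀ i, q.coeff i ≤ K)
    (hp : ∀ i, p.coeff i ≤ K') (a k i : ℕ) :
    ((divStep p)^[k] (q, a)).1.coeff i ≤ K + k * K' := by
  induction k generalizing i with
  | zero => simpa using hq i
  | succ k ih =>
    rw [Function.iterate_succ_apply', divStep, coeff_divX, add_mul, one_mul, ← add_assoc]
    exact coeff_add_mul_le ih hp _

theorem coeff_iterate_divStep_eq_zero {p q : ℕ[X]} {L : ℕ} (hq : ∀ i, L ≤ i → q.coeff i = 0)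
    (hp : ∀ i, L ≤ i → p.coeff i = 0) (a k i : ℕ) (hi : L ≤ i) :
    ((divStep p)^[k] (q, a)).1.coeff i = 0 := by
  induction k generalizing i with
  | zero => exact hq i hi
  | succ k ih =>
    rw [Function.iterate_succ_apply', divStep, coeff_divX]
    exact coeff_add_mul_eq_zero ih hp _ (by omega)

theorem iterate_divStep_snd_le (p q : ℕ[X]) (a k : ℕ) :
    ((divStep p)^[k] (q, a)).2 ≤ a + k := by
  induction k with
  | zero => simp
  | succ k ih =>
    rw [Function.iterate_succ_apply', divStep]
    dsimp only
    omega

/-- With divisor `0` the step only shifts, so the counter gains the number of odd coefficients. This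
makes the division loop double as the test for zero. -/
theorem iterate_divStep_zero_snd_eq_zero_iff {q : ℕ[X]} {k : ℕ}
    (hq : ∀ i, k ≤ i → q.coeff i = 0) (a : ℕ) :
    ((divStep 0)^[k] (q, a)).2 = 0 ↔ a = 0 ∧ red q = 0 := by
  induction k generalizing q a with
  | zero =>
    have : q = 0 := by ext i; simpa using hq i (Nat.zero_le i)
    simp [this]
  | succ k ih =>
    rw [Function.iterate_succ_apply, divStep]
    simp only [mul_zero, add_zero]
    rw [ih fun i hi => by rw [coeff_divX]; exact hq _ (by omega)]
    simp only [red_eq_zero_iff, coeff_divX, Nat.add_eq_zero_iff, and_assoc]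
    refine and_congr_right fun _ => ⟨fun h i => ?_, fun h => ⟨h 0, fun i => h _⟩⟩
    cases i with
    | zero => exact h.1
    | succ i => exact h.2 i

theorem natCast_mod_two (n : ℕ) : ((n % 2 : ℕ) : ZMod 2) = n := by simp

theorem red_add_mul (p q : ℕ[X]) :
    red (q + C (q.coeff 0 % 2) * p) = red q + C ((red q).coeff 0) * red p := by
  ext i
  simp only [coeff_red, coeff_add, coeff_C_mul, Nat.cast_add, Nat.cast_mul, natCast_mod_two]

theorem coeff_add_mul_zero_mod_two {p : ℕ[X]} (hp : p.coeff 0 % 2 = 1) (q : ℕ[X]) :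
    (q + C (q.coeff 0 % 2) * p).coeff 0 % 2 = 0 := by
  rw [coeff_add, coeff_C_mul, Nat.add_mod, Nat.mul_mod, hp]
  omega

theorem isCoprime_X_pow {F : Type*} [Field F] {p : F[X]} (hp : p.coeff 0 ≠ 0) (k : ℕ) :
    IsCoprime p (X ^ k) := by
  refine IsCoprime.pow_right (IsCoprime.symm ?_)
  exact (Polynomial.prime_X.irreducible.coprime_iff_not_dvd).2 (by rwa [X_dvd_iff])

/-- Modulo two the step adds a multiple of `p` and then divides exactly by `X`, which is coprime to
`p`. -/
theorem red_dvd_red_divStep {p : ℕ[X]} (hp : p.coeff 0 % 2 = 1) (q : ℕ[X]) (a : ℕ) :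
    red p ∣ red (divStep p (q, a)).1 ↔ red p ∣ red q := by
  have hp' : (red p).coeff 0 ≠ 0 := by
    rw [coeff_red, Ne, ZMod.natCast_eq_zero_iff]; omega
  have h0 : (red (q + C (q.coeff 0 % 2) * p)).coeff 0 = 0 := by
    rw [coeff_red, ZMod.natCast_eq_zero_iff]
    exact Nat.dvd_of_mod_eq_zero (coeff_add_mul_zero_mod_two hp q)
  have h1 : red (divStep p (q, a)).1 * X ^ 1 = red q + C ((red q).coeff 0) * red p := by
    have := (red (q + C (q.coeff 0 % 2) * p)).divX_mul_X_add
    rw [h0, C_0, add_zero] at this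
    rw [divStep, red_divX, pow_one, this, red_add_mul]
  have h2 : red p ∣ red (divStep p (q, a)).1 ↔ red p ∣ red (divStep p (q, a)).1 * X ^ 1 :=
    ⟨fun h => h.mul_right _, (isCoprime_X_pow hp' 1).dvd_of_dvd_mul_right⟩
  rw [h2, h1]
  exact dvd_add_left (Dvd.intro_left _ rfl)

theorem iterate_divStep_of_odd {p q : ℕ[X]} (hp : p.coeff 0 % 2 = 1) (a k : ℕ) :
    ((divStep p)^[k] (q, a)).2 = a ∧
      (red p ∣ red ((divStep p)^[k] (q, a)).1 ↔ red p ∣ red q) := by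
  induction k with
  | zero => simp
  | succ k ih =>
    rw [Function.iterate_succ_apply']
    refine ⟨?_, (red_dvd_red_divStep hp _ _).trans ih.2⟩
    rw [divStep, coeff_add_mul_zero_mod_two hp, add_zero, ih.1]

/-- Above the degree of `red p` adding a multiple of `p` has no effect, so there a step is a pure
shift and zeros move down by one. -/
theorem coeff_red_iterate_divStep {p q : ℕ[X]} {L : ℕ} (hq : ∀ i, L ≤ i → q.coeff i = 0)
    (a k i : ℕ) (hi : L ≤ i + k) (hi' : (red p).natDegree ≤ i) :
    (red ((divStep p)^[k] (q, a)).1).coeff i = 0 := by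
  induction k generalizing i with
  | zero => rw [coeff_red]; simp [hq i hi]
  | succ k ih =>
    rw [Function.iterate_succ_apply', divStep, red_divX, coeff_divX, red_add_mul, coeff_add,
      coeff_C_mul, coeff_eq_zero_of_natDegree_lt (p := red p) (by omega), mul_zero, add_zero,
      ih (i + 1) (by omega) (by omega)]

/-- For odd `p` the first pass leaves the counter alone and produces a `q` of degree below `p`,
which the second pass tests for zero. For `p = 0` both passes count odd coefficients, in agreement
with `0` dividing only `0`. -/
theorem iterate_divStep_eq_zero_iff_dvd {p q : ℕ[X]} {L : ℕ}
    (hp : p = 0 ∨ p.coeff 0 % 2 = 1) (hpL : ∀ i, L ≤ i → p.coeff i = 0)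
    (hqL : ∀ i, L ≤ i → q.coeff i = 0) (a : ℕ) :
    ((divStep 0)^[L] ((divStep p)^[L] (q, a))).2 = 0 ↔ a = 0 ∧ red p ∣ red q := by
  rcases hp with rfl | hp
  · rw [← Function.iterate_add_apply, iterate_divStep_zero_snd_eq_zero_iff
      (fun i hi => hqL i (by omega)), map_zero, zero_dvd_iff]
  · obtain ⟨h1, h2⟩ := iterate_divStep_of_odd (q := q) hp a L
    have h3 := iterate_divStep_zero_snd_eq_zero_iff (k := L)
      (coeff_iterate_divStep_eq_zero hqL hpL a L) ((divStep p)^[L] (q, a)).2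
    rw [Prod.mk.eta] at h3
    rw [h3, h1, ← h2]
    refine and_congr_right fun _ => ⟨fun h => by rw [h]; exact dvd_zero _, fun h => ?_⟩
    have hp0 : red p ≠ 0 := by
      intro h0
      have := red_eq_zero_iff.1 h0 0
      omega
    refine eq_zero_of_dvd_of_degree_lt h ?_
    rw [degree_eq_natDegree hp0, degree_lt_iff_coeff_zero]
    intro i hi
    exact coeff_red_iterate_divStep hqL a L i (by omega) hi

/-- Clearing denominators in a Laurent quotient gives `p ∣ q * X ^ n`, and the power of `X` cancels
by coprimality. -/
theorem toLaurent_dvd_toLaurent {F : Type*} [Field F] {p q : F[X]} (hp : p = 0 ∨ p.coeff 0 ≠ 0) :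
    toLaurent p ∣ toLaurent q ↔ p ∣ q := by
  refine ⟨fun h => ?_, fun h => map_dvd _ h⟩
  obtain ⟨g, hg⟩ := h
  rcases hp with rfl | hp
  · rw [map_zero, zero_mul] at hg
    rw [zero_dvd_iff]
    exact toLaurent_injective (by rw [hg, map_zero])
  · obtain ⟨n, f, hf⟩ := g.exists_T_pow
    refine (isCoprime_X_pow hp n).dvd_of_dvd_mul_right (Dvd.intro f ?_)
    apply toLaurent_injective
    rw [map_mul, map_mul, hf, hg, toLaurent_X_pow, mul_assoc]

theorem toLaurent_red_dvd_iff {p q : ℕ[X]} {L : ℕ} (hpL : ∀ i, L ≤ i → p.coeff i = 0) :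
    toLaurent (red p) ∣ toLaurent (red q) ↔ red (normStep^[L] p) ∣ red q := by
  obtain ⟨k, hk⟩ := red_iterate_normStep p L
  rw [← toLaurent_dvd_toLaurent (p := red (normStep^[L] p)), hk, map_mul, toLaurent_X_pow]
  · exact (LaurentPolynomial.isUnit_T (k : ℤ)).mul_left_dvd
  · rcases iterate_normStep_eq_zero_or hpL with h | h
    · left; rw [h, map_zero]
    · right
      rw [coeff_red, Ne, ZMod.natCast_eq_zero_iff]; omega

end ParityPoly

/-! ### Numerator and denominator as polynomials with natural coefficients -/

namespace EqWord

open Polynomial ParityPoly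

/-- The sum of `X ^ e v` over the suffixes `v` of the word that follow a letter `a` or `a⁻¹`. -/
noncomputable def numPoly (e : EqWord → ℕ) : EqWord → ℕ[X]
  | [] => 0
  | (EqGen.a, _) :: w => numPoly e w + X ^ e w
  | _ :: w => numPoly e w

/-- The sum of `X ^ e v` over the suffixes `v` of the word that follow a letter `x` or start with
a letter `x⁻¹`. -/
noncomputable def denPoly (e : EqWord → ℕ) : EqWord → ℕ[X]
  | [] => 0
  | (EqGen.x, b) :: w => denPoly e w + X ^ e (if b then w else (EqGen.x, b) :: w)
  | _ :: w => denPoly e w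

theorem coeff_add_X_pow_le {p : ℕ[X]} {K : ℕ} (i k : ℕ) (h : p.coeff i ≤ K) :
    (p + X ^ k).coeff i ≤ K + 1 := by
  rw [coeff_add, coeff_X_pow]
  split <;> omega

theorem coeff_numPoly_le (e : EqWord → ℕ) (w : EqWord) (i : ℕ) :
    (numPoly e w).coeff i ≤ w.length := by
  induction w with
  | nil => simp [numPoly]
  | cons y w ih =>
    rcases y with ⟨_ | _ | _, b⟩
    · exact coeff_add_X_pow_le _ _ ih
    · exact ih.trans (Nat.le_succ _)
    · exact ih.trans (Nat.le_succ _)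

theorem coeff_denPoly_le (e : EqWord → ℕ) (w : EqWord) (i : ℕ) :
    (denPoly e w).coeff i ≤ w.length := by
  induction w with
  | nil => simp [denPoly]
  | cons y w ih =>
    rcases y with ⟨_ | _ | _, b⟩
    · exact ih.trans (Nat.le_succ _)
    · exact ih.trans (Nat.le_succ _)
    · exact coeff_add_X_pow_le _ _ ih

theorem coeff_numPoly_eq_zero {e : EqWord → ℕ} {n i : ℕ} (he : ∀ v, v.length ≤ n → e v < i)
    (w : EqWord) (hw : w.length ≤ n) : (numPoly e w).coeff i = 0 := by
  induction w with
  | nil => simp [numPoly]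
  | cons y w ih =>
    rw [List.length_cons] at hw
    rcases y with ⟨_ | _ | _, b⟩
    · rw [numPoly, coeff_add, ih (by omega), coeff_X_pow, if_neg (he w (by omega)).ne',
        add_zero]
    · exact ih (by omega)
    · exact ih (by omega)

theorem coeff_denPoly_eq_zero {e : EqWord → ℕ} {n i : ℕ} (he : ∀ v, v.length ≤ n → e v < i)
    (w : EqWord) (hw : w.length ≤ n) : (denPoly e w).coeff i = 0 := by
  induction w with
  | nil => simp [denPoly]
  | cons y w ih =>
    have hw' := hw
    rw [List.length_cons] at hw
    rcases y with ⟨_ | _ | _, b⟩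
    · exact ih (by omega)
    · exact ih (by omega)
    · rw [denPoly, coeff_add, ih (by omega), coeff_X_pow, if_neg (he _ ?_).ne', add_zero]
      split
      · omega
      · exact hw'

theorem toLaurent_red_X_pow {E : ℕ} {k : ℕ} {d : ℤ} (h : (k : ℤ) = E - d) :
    toLaurent (red (X ^ k)) = T (E : ℤ) * T (-d) := by
  rw [red_X_pow, toLaurent_X_pow, h, sub_eq_add_neg, LaurentPolynomial.T_add]

/-- The offset `E` makes all exponents nonnegative. The denominator gets the same unit factor `T E`,
so divisibility is unaffected. -/
theorem toLaurent_red_numPoly {E : ℕ} {δ : ℤ} {e : EqWord → ℕ} {n : ℕ}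
    (he : ∀ v, v.length ≤ n → (e v : ℤ) = E - posAt δ v) (w : EqWord) (hw : w.length ≤ n) :
    toLaurent (red (numPoly e w)) = T (E : ℤ) * w.num δ := by
  induction w with
  | nil => simp [numPoly, num_nil]
  | cons y w ih =>
    rw [List.length_cons] at hw
    have ih := ih (by omega)
    rcases y with ⟨_ | _ | _, b⟩
    · rw [numPoly, map_add, map_add, ih, num_a, mul_add, toLaurent_red_X_pow (he w (by omega))]
    · rw [num_t]; exact ih
    · rw [num_x]; exact ih

theorem toLaurent_red_denPoly {E : ℕ} {δ : ℤ} {e : EqWord → ℕ} {n : ℕ}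
    (he : ∀ v, v.length ≤ n → (e v : ℤ) = E - posAt δ v) (w : EqWord) (hw : w.length ≤ n) :
    toLaurent (red (denPoly e w)) = T (E : ℤ) * w.den δ := by
  induction w with
  | nil => simp [denPoly, den_nil]
  | cons y w ih =>
    have hw' := hw
    rw [List.length_cons] at hw
    have ih := ih (by omega)
    rcases y with ⟨_ | _ | _, b⟩
    · rw [den_a]; exact ih
    · rw [den_t]; exact ih
    · rw [denPoly, map_add, map_add, ih, den_x, mul_add, toLaurent_red_X_pow (he _ ?_)]
      split
      · omega
      · exact hw'

theorem abs_posAt_le {δ : ℤ} {D : ℕ} (hD : 1 ≤ D) (hδ : |δ| ≤ D) (w : EqWord) :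
    |posAt δ w| ≤ (w.length * D : ℕ) := by
  induction w with
  | nil => simp [posAt]
  | cons y w ih =>
    rw [abs_le] at hδ ih ⊢
    rw [List.length_cons, add_mul, one_mul, Nat.cast_add]
    rcases y with ⟨_ | _ | _, _ | _⟩ <;> simp only [posAt, expo] <;> constructor <;>
      norm_num <;> omega

end EqWord

/-! ### The program -/

namespace RandomAccess

/-- The memory `m'` agrees with `m` outside of the registers in `R`. -/
def SameOff (R : List ℤ) (m m' : ℤ → ℤ) : Prop := ∀ i, i ∉ R → m' i = m i

theorem SameOff.refl (R : List ℤ) (m : ℤ → ℤ) : SameOff R m m := fun _ _ => rfl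

theorem SameOff.update {R : List ℤ} {m m' : ℤ → ℤ} (h : SameOff R m m') {d v : ℤ} (hd : d ∈ R) :
    SameOff R m (Function.update m' d v) := by
  intro i hi
  rw [Function.update_of_ne (by rintro rfl; exact hi hd), h i hi]

theorem sub_ediv_two_mul_two (x : ℤ) : x - x / 2 * 2 = x % 2 := by omega

/-- Multiply register `q` by the base, which is in register `-14`, as often as register `-4`
says. -/
def powLoop (q : ℤ) : Cmd := .loop (-4) [.mul q q (-14), .sub (-4) (-4) (-1)]

theorem leads_powLoop {K : ℤ} {l : List Cmd} {m : ℤ → ℤ} {Q : (ℤ → ℤ) → Prop} {N : ℕ} {q : ℤ}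
    {B J : ℕ} (hq : q ∉ [-1, -4, -14]) (h1 : m (-1) = 1) (hB : m (-14) = B) (hJ : m (-4) = J)
    (hq1 : m q = 1) (hK : ((B ^ J : ℕ) : ℤ) ≤ K) (hJK : (J : ℤ) ≤ K) (hB1 : 1 ≤ B)
    (hl : ∀ m', SameOff [q, -4] m m' → m' q = ((B ^ J : ℕ) : ℤ) → Leads K l m' Q N) :
    Leads K (powLoop q :: l) m Q (J * 4 + 1 + N) := by
  simp only [List.mem_cons, List.not_mem_nil, or_false, not_or] at hq
  obtain ⟨hq1', hq4, hq14⟩ := hq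
  refine Leads.loop (fun j m' => SameOff [q, -4] m m' ∧ m' (-4) = j ∧
    ∃ i, i + j = J ∧ m' q = ((B ^ i : ℕ) : ℤ)) J ⟨SameOff.refl _ _, hJ, 0, by omega, by simpa⟩
    (fun j m h => h.2.1) ?_ ?_
  · rintro j hj m' ⟨hs, hc, i, hi, hqi⟩
    have e1 : m' (-1) = 1 := by rw [hs _ (by simp [Ne.symm hq1']), h1]
    have eB : m' (-14) = B := by rw [hs _ (by simp [Ne.symm hq14]), hB]
    have hle : B ^ (i + 1) ≤ B ^ J := Nat.pow_le_pow_right hB1 (by omega)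
    have hle' : ((B ^ (i + 1) : ℕ) : ℤ) ≤ K := le_trans (by exact_mod_cast hle) hK
    have hval : ((B ^ i : ℕ) : ℤ) * B = ((B ^ (i + 1) : ℕ) : ℤ) := by
      rw [pow_succ, Nat.cast_mul]
    simp only [BlockTo, Instr.assign, Function.update_apply, Ne.symm hq4, Ne.symm hq1', if_false,
      e1, eB, hqi, hval, hc]
    refine ⟨by rwa [Nat.abs_cast], by rw [abs_le]; push_cast at *; omega,
      (hs.update (by simp)).update (by simp), ?_, i + 1, by omega, ?_⟩
    · simp
    · simp [hq4]
  · rintro m' ⟨hs, _, i, hi, hqi⟩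
    exact hl m' hs (by rw [hqi, show i = J by omega])

/-- Compute the exponent sums of `x` and `t` in registers `-7` and `-8`. -/
def scanBody : List Instr :=
  [.load (-5) (-4), .add (-6) (-5) (-9), .div (-6) (-6) (-10), .sub (-11) (-9) (-5),
    .div (-11) (-11) (-10), .add (-7) (-7) (-6), .sub (-7) (-7) (-11), .div (-6) (-5) (-2),
    .mul (-11) (-6) (-2), .sub (-11) (-5) (-11), .sub (-11) (-1) (-11), .mul (-6) (-6) (-11),
    .add (-8) (-8) (-6), .sub (-4) (-4) (-1)]

theorem abs_sigmaX_le (w : EqWord) : |w.sigmaX| ≤ w.length := by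
  induction w with
  | nil => simp [EqWord.sigmaX]
  | cons y w ih =>
    rw [abs_le] at *
    rcases y with ⟨_ | _ | _, _ | _⟩ <;> simp only [EqWord.sigmaX, EqWord.expo, List.length_cons]
      <;> push_cast <;> constructor <;> norm_num <;> omega

theorem drop_eq_cons_letter {w : EqWord} {j : ℕ} (hj : j < w.length) :
    ∃ y b, w.drop j = (y, b) :: w.drop (j + 1) ∧
      w.inputMemory ((j : ℤ) + 1) = EqWord.letterCode (y, b) := by
  refine ⟨w[j].1, w[j].2, List.drop_eq_getElem_cons hj, ?_⟩
  rw [EqWord.inputMemory, if_neg (by omega), if_pos (by omega)]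
  simp [hj]

/-- Words are read from right to left, since all quantities are functions of suffixes: with counter
`j` the suffix `w.drop j` has been processed. -/
structure ScanInv (w : EqWord) (m : ℤ → ℤ) (j : ℕ) (m' : ℤ → ℤ) : Prop where
  same : SameOff [-4, -5, -6, -7, -8, -11] m m'
  counter : m' (-4) = j
  sum_x : m' (-7) = EqWord.sigmaX (w.drop j)
  sum_t : m' (-8) = EqWord.posAt 0 (w.drop j)

/-- For a letter code `v`, the quotients `(v + 3) / 6` and `(3 - v) / 6` are the indicators of `x`
and `x⁻¹`. Only `t` and `t⁻¹` have even codes, so `(v / 2) * (1 - v % 2)` is the exponent of `t`. -/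
theorem leads_scan {K : ℤ} {l : List Cmd} {m : ℤ → ℤ} {Q : (ℤ → ℤ) → Prop} {N : ℕ}
    {w : EqWord} (h1 : m (-1) = 1) (h2 : m (-2) = 2) (h3 : m (-9) = 3) (h6 : m (-10) = 6)
    (hJ : m (-4) = w.length) (hs0 : m (-7) = 0) (ht0 : m (-8) = 0)
    (hw : ∀ i, 1 ≤ i → m i = w.inputMemory i) (hK : (w.length : ℤ) + 10 ≤ K)
    (hl : ∀ m', SameOff [-4, -5, -6, -7, -8, -11] m m' → m' (-7) = w.sigmaX →
      m' (-8) = EqWord.posAt 0 w → Leads K l m' Q N) :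
    Leads K (.loop (-4) scanBody :: l) m Q (w.length * 16 + 1 + N) := by
  refine Leads.loop (ScanInv w m) w.length ⟨SameOff.refl _ _, hJ, ?_, ?_⟩
    (fun j m h => h.counter) ?_ ?_
  · simpa [EqWord.sigmaX] using hs0
  · simpa [EqWord.posAt] using ht0
  · rintro j hj m' ⟨hs, hc, hx, ht⟩
    obtain ⟨y, b, hd, hy⟩ := drop_eq_cons_letter hj
    have e1 : m' (-1) = 1 := by rw [hs _ (by decide), h1]
    have e2 : m' (-2) = 2 := by rw [hs _ (by decide), h2]
    have e3 : m' (-9) = 3 := by rw [hs _ (by decide), h3]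
    have e6 : m' (-10) = 6 := by rw [hs _ (by decide), h6]
    have ec : m' ((j : ℤ) + 1) = EqWord.letterCode (y, b) := by
      rw [hs _ (by simp; omega), hw _ (by omega), hy]
    have bx := abs_sigmaX_le (w.drop (j + 1))
    have bt := EqWord.abs_posAt_le (δ := 0) le_rfl (by simp) (w.drop (j + 1))
    rw [mul_one] at bt
    have hlen : ((w.drop (j + 1)).length : ℤ) ≤ w.length := by simp
    rw [abs_le] at bx bt
    push_cast at hc
    have hj' : (j : ℤ) < w.length := by exact_mod_cast hj
    rcases y with _ | _ | _ <;> rcases b with _ | _ <;>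
      simp [scanBody, BlockTo, Instr.assign, e1, e2, e3, e6, hc, ec,
        EqWord.letterCode, EqWord.expo, hx, ht] <;>
      and_intros
    all_goals try first
      | (rw [abs_le]; omega)
      | omega
    all_goals
      constructor
      · repeat refine SameOff.update ?_ (by decide)
        exact hs
      · simp
      · simp [hd, EqWord.sigmaX, EqWord.expo]
        try ring
      · simp [hd, EqWord.posAt, EqWord.expo]
        try ring
  · rintro m' ⟨hs, _, hx, ht⟩
    exact hl m' hs (by simpa using hx) (by simpa using ht)

/-- Update the power of the base in register `-16` and the two packed polynomials in registers
`-25` and `-26` for one letter. -/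
def letterBody : List Instr :=
  [.load (-5) (-4), .add (-6) (-5) (-9), .div (-6) (-6) (-10), .sub (-11) (-9) (-5),
    .div (-11) (-11) (-10), .div (-27) (-5) (-2), .mul (-27) (-27) (-2), .sub (-27) (-5) (-27),
    .sub (-27) (-27) (-6), .sub (-27) (-27) (-11), .mul (-27) (-27) (-16),
    .add (-25) (-25) (-27), .mul (-6) (-6) (-16), .add (-26) (-26) (-6), .add (-5) (-5) (-24),
    .load (-5) (-5), .mul (-16) (-16) (-5), .div (-16) (-16) (-19), .mul (-11) (-11) (-16),
    .add (-26) (-26) (-11), .sub (-4) (-4) (-1)]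

structure LetterInv (w : EqWord) (Nv Dv Qv : EqWord → ℕ) (m : ℤ → ℤ) (j : ℕ) (m' : ℤ → ℤ) :
    Prop where
  same : SameOff [-4, -5, -6, -11, -16, -25, -26, -27] m m'
  counter : m' (-4) = j
  power : m' (-16) = Qv (w.drop j)
  num : m' (-25) = Nv (w.drop j)
  den : m' (-26) = Dv (w.drop j)

/-- The parity of the code minus the indicators of `x` and `x⁻¹` is the indicator of `a` and `a⁻¹`.
The power is updated between the contributions of `x` and `x⁻¹`, because the latter uses the suffix
that contains the letter. The factor for code `v` is in register `v - 20`; division by the factor of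
`a` removes the offset common to all factors. -/
theorem leads_letters {K : ℤ} {l : List Cmd} {m : ℤ → ℤ} {Q : (ℤ → ℤ) → Prop} {N : ℕ}
    {w : EqWord} {Nv Dv Qv : EqWord → ℕ} {Fv : EqGen → Bool → ℕ}
    (h1 : m (-1) = 1) (h2 : m (-2) = 2) (h3 : m (-9) = 3) (h6 : m (-10) = 6)
    (h20 : m (-24) = -20) (hJ : m (-4) = w.length)
    (hN0 : m (-25) = Nv []) (hD0 : m (-26) = Dv []) (hQ0 : m (-16) = Qv [])
    (hw : ∀ i, 1 ≤ i → m i = w.inputMemory i)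
    (hF : ∀ y b, m (EqWord.letterCode (y, b) - 20) = Fv y b)
    (hQ : ∀ y b u, ((y, b) :: u).length ≤ w.length →
      Qv u * Fv y b / Fv EqGen.a true = Qv ((y, b) :: u))
    (hNa : ∀ b u, Nv ((EqGen.a, b) :: u) = Nv u + Qv u)
    (hNt : ∀ b u, Nv ((EqGen.t, b) :: u) = Nv u)
    (hNx : ∀ b u, Nv ((EqGen.x, b) :: u) = Nv u)
    (hDa : ∀ b u, Dv ((EqGen.a, b) :: u) = Dv u)
    (hDt : ∀ b u, Dv ((EqGen.t, b) :: u) = Dv u)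
    (hDx : ∀ u, Dv ((EqGen.x, true) :: u) = Dv u + Qv u)
    (hDx' : ∀ u, Dv ((EqGen.x, false) :: u) = Dv u + Qv ((EqGen.x, false) :: u))
    (hNK : ∀ u, u.length ≤ w.length → (Nv u : ℤ) ≤ K)
    (hDK : ∀ u, u.length ≤ w.length → (Dv u : ℤ) ≤ K)
    (hQK : ∀ u, u.length ≤ w.length → (Qv u : ℤ) ≤ K)
    (hFK : ∀ y b, (Fv y b : ℤ) ≤ K)
    (hQFK : ∀ y b u, u.length ≤ w.length → (Qv u * Fv y b : ℤ) ≤ K)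
    (hK : (w.length : ℤ) + 30 ≤ K)
    (hl : ∀ m', SameOff [-4, -5, -6, -11, -16, -25, -26, -27] m m' → m' (-25) = Nv w →
      m' (-26) = Dv w → Leads K l m' Q N) :
    Leads K (.loop (-4) letterBody :: l) m Q (w.length * 23 + 1 + N) := by
  refine Leads.loop (LetterInv w Nv Dv Qv m) w.length ⟨SameOff.refl _ _, hJ, ?_, ?_, ?_⟩
    (fun j m h => h.counter) ?_ ?_
  · simpa using hQ0
  · simpa using hN0
  · simpa using hD0
  · rintro j hj m' ⟨hs, hc, hq, hn, hde⟩
    obtain ⟨y, b, hd, hy⟩ := drop_eq_cons_letter hj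
    have e1 : m' (-1) = 1 := by rw [hs _ (by decide), h1]
    have e2 : m' (-2) = 2 := by rw [hs _ (by decide), h2]
    have e3 : m' (-9) = 3 := by rw [hs _ (by decide), h3]
    have e6 : m' (-10) = 6 := by rw [hs _ (by decide), h6]
    have e20 : m' (-24) = -20 := by rw [hs _ (by decide), h20]
    have eW : m' (-19) = Fv EqGen.a true := by rw [hs _ (by decide)]; exact hF EqGen.a true
    have ec : m' ((j : ℤ) + 1) = EqWord.letterCode (y, b) := by
      rw [hs _ (by simp; omega), hw _ (by omega), hy]
    have eF : m' (EqWord.letterCode (y, b) - 20) = Fv y b := by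
      rw [hs _ (by cases y <;> cases b <;> decide), hF]
    have hlen : (w.drop j).length ≤ w.length := by simp
    have hlen' : (w.drop (j + 1)).length ≤ w.length := by simp
    rw [hd] at hlen
    have bN := hNK _ hlen
    have bD := hDK _ hlen
    have bQ := hQK _ hlen
    have bN' := hNK _ hlen'
    have bD' := hDK _ hlen'
    have bQ' := hQK _ hlen'
    have bF := hFK y b
    have bQF := hQFK y b _ hlen'
    have eQ : (Qv (w.drop (j + 1)) * Fv y b : ℤ) / Fv EqGen.a true =
        Qv ((y, b) :: w.drop (j + 1)) := by
      exact_mod_cast hQ y b _ hlen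
    push_cast at hc
    have hj' : (j : ℤ) < w.length := by exact_mod_cast hj
    have q0 : (0 : ℤ) ≤ Qv (w.drop (j + 1)) * Fv y b := by positivity
    rcases y with _ | _ | _ <;> rcases b with _ | _ <;>
      simp only [hNa, hNt, hNx, hDa, hDt, hDx, hDx', Nat.cast_add] at bN bD <;>
      simp only [EqWord.letterCode, EqWord.expo] at eF ec <;>
      norm_num at eF ec <;>
      simp [letterBody, BlockTo, Instr.assign, e1, e2, e3, e6, e20, eW, eF, eQ, hc, ec, hq,
        hn, hde, -abs_mul] <;>
      and_intros
    all_goals try first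
      | (rw [abs_le]; omega)
      | omega
    all_goals
      constructor
      · repeat refine SameOff.update ?_ (by decide)
        exact hs
      · simp
      · simp [hd]
      · simp [hd, hNa, hNt, hNx]
      · simp [hd, hDa, hDt, hDx, hDx']
  · rintro m' ⟨hs, _, _, hn, hde⟩
    exact hl m' hs (by simpa using hn) (by simpa using hde)

/-- Divide the packed polynomial in register `-26` by the variable if its constant coefficient is
even. -/
def normBody : List Instr :=
  [.div (-5) (-26) (-2), .mul (-5) (-5) (-2), .sub (-5) (-26) (-5), .sub (-6) (-14) (-1),
    .mul (-6) (-6) (-5), .sub (-6) (-14) (-6), .div (-26) (-26) (-6), .sub (-4) (-4) (-1)]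

/-- The divisor `B - (B - 1) * parity` is `B` for an even value and `1` for an odd one, which avoids
a branch inside the loop body. -/
theorem leads_norm {K : ℤ} {l : List Cmd} {m : ℤ → ℤ} {Q : (ℤ → ℤ) → Prop} {N : ℕ}
    {Dv : ℕ → ℕ} {B J : ℕ} (h1 : m (-1) = 1) (h2 : m (-2) = 2) (hB : m (-14) = B)
    (hJ : m (-4) = J) (hD0 : m (-26) = Dv 0)
    (hD : ∀ i < J, Dv (i + 1) = if Dv i % 2 = 0 then Dv i / B else Dv i)
    (hDK : ∀ i ≤ J, (Dv i : ℤ) ≤ K) (hK : (J : ℤ) ≤ K) (hBK : (B : ℤ) ≤ K) (hB1 : 1 ≤ B)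
    (hl : ∀ m', SameOff [-4, -5, -6, -26] m m' → m' (-26) = Dv J → Leads K l m' Q N) :
    Leads K (.loop (-4) normBody :: l) m Q (J * 10 + 1 + N) := by
  refine Leads.loop (fun j m' => SameOff [-4, -5, -6, -26] m m' ∧ m' (-4) = j ∧
    ∃ i, i + j = J ∧ m' (-26) = Dv i) J ⟨SameOff.refl _ _, hJ, 0, by omega, hD0⟩
    (fun j m h => h.2.1) ?_ ?_
  · rintro j hj m' ⟨hs, hc, i, hi, hd⟩
    have e1 : m' (-1) = 1 := by rw [hs _ (by decide), h1]
    have e2 : m' (-2) = 2 := by rw [hs _ (by decide), h2]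
    have eB : m' (-14) = B := by rw [hs _ (by decide), hB]
    have b := hDK i (by omega)
    have b' := hDK (i + 1) (by omega)
    have hstep := hD i (by omega)
    simp only [normBody, BlockTo, Instr.assign, Function.update_apply, Int.reduceNeg,
      Int.reduceEq, if_true, if_false, e1, e2, eB, hd, hc, sub_ediv_two_mul_two]
    rcases Nat.mod_two_eq_zero_or_one (Dv i) with h | h
    · have hz : (Dv i : ℤ) % 2 = 0 := by omega
      rw [if_pos h] at hstep
      have hz' : (Dv i : ℤ) / B = (Dv (i + 1) : ℕ) := by rw [hstep]; norm_cast
      simp only [hz, mul_zero, sub_zero, hz']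
      and_intros
      all_goals try first
        | (rw [abs_le]; push_cast at *; omega)
        | omega
      · repeat refine SameOff.update ?_ (by decide)
        exact hs
      · exact ⟨i + 1, by omega, by simp⟩
    · have hz : (Dv i : ℤ) % 2 = 1 := by omega
      rw [if_neg (by omega)] at hstep
      simp only [hz, mul_one, sub_sub_cancel, Int.ediv_one]
      and_intros
      all_goals try first
        | (rw [abs_le]; push_cast at *; omega)
        | omega
      · repeat refine SameOff.update ?_ (by decide)
        exact hs
      · exact ⟨i + 1, by omega, by simp [hstep]⟩
  · rintro m' ⟨hs, _, i, hi, hd⟩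
    exact hl m' hs (by rw [hd, show i = J by omega])

/-- A division step for the packed polynomials in registers `-25` and `-26`; the number of odd
remainders is counted in register `-13`. -/
def divBody : List Instr :=
  [.div (-5) (-25) (-2), .mul (-5) (-5) (-2), .sub (-5) (-25) (-5), .mul (-5) (-5) (-26),
    .add (-25) (-25) (-5), .div (-5) (-25) (-2), .mul (-5) (-5) (-2), .sub (-5) (-25) (-5),
    .add (-13) (-13) (-5), .div (-25) (-25) (-14), .sub (-4) (-4) (-1)]

theorem leads_div {K : ℤ} {l : List Cmd} {m : ℤ → ℤ} {Q : (ℤ → ℤ) → Prop} {N : ℕ}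
    {Nv Av : ℕ → ℕ} {D B J : ℕ} (h1 : m (-1) = 1) (h2 : m (-2) = 2) (hB : m (-14) = B)
    (hJ : m (-4) = J) (hD : m (-26) = D) (hN0 : m (-25) = Nv 0) (hA0 : m (-13) = Av 0)
    (hN : ∀ i < J, Nv (i + 1) = (Nv i + Nv i % 2 * D) / B)
    (hA : ∀ i < J, Av (i + 1) = Av i + (Nv i + Nv i % 2 * D) % 2)
    (hNK : ∀ i ≤ J, (Nv i : ℤ) ≤ K) (hNK' : ∀ i < J, ((Nv i + Nv i % 2 * D : ℕ) : ℤ) ≤ K)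
    (hAK : ∀ i ≤ J, (Av i : ℤ) ≤ K) (hK : (J : ℤ) ≤ K) (hK1 : 1 ≤ K)
    (hl : ∀ m', SameOff [-4, -5, -13, -25] m m' → m' (-25) = Nv J → m' (-13) = Av J →
      Leads K l m' Q N) :
    Leads K (.loop (-4) divBody :: l) m Q (J * 13 + 1 + N) := by
  refine Leads.loop (fun j m' => SameOff [-4, -5, -13, -25] m m' ∧ m' (-4) = j ∧
    ∃ i, i + j = J ∧ m' (-25) = Nv i ∧ m' (-13) = Av i) J
    ⟨SameOff.refl _ _, hJ, 0, by omega, hN0, hA0⟩ (fun j m h => h.2.1) ?_ ?_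
  · rintro j hj m' ⟨hs, hc, i, hi, hn, ha⟩
    have e1 : m' (-1) = 1 := by rw [hs _ (by decide), h1]
    have e2 : m' (-2) = 2 := by rw [hs _ (by decide), h2]
    have eB : m' (-14) = B := by rw [hs _ (by decide), hB]
    have eD : m' (-26) = D := by rw [hs _ (by decide), hD]
    obtain ⟨S, hS⟩ : ∃ S, S = Nv i + Nv i % 2 * D := ⟨_, rfl⟩
    have hS' : (Nv i : ℤ) + (Nv i : ℤ) % 2 * D = S := by rw [hS]; push_cast; rfl
    have bS := hNK' i (by omega)
    have bN := hNK i (by omega)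
    have bN' := hNK (i + 1) (by omega)
    have bA := hAK i (by omega)
    have bA' := hAK (i + 1) (by omega)
    have sN := hN i (by omega)
    have sA := hA i (by omega)
    rw [← hS] at bS sN sA
    have hSB : (S : ℤ) / B = (Nv (i + 1) : ℕ) := by rw [sN]; norm_cast
    have hSA : (Av i : ℤ) + (S : ℤ) % 2 = (Av (i + 1) : ℕ) := by rw [sA]; push_cast; rfl
    have hP : (0 : ℤ) ≤ (Nv i : ℤ) % 2 * D :=
      mul_nonneg (Int.emod_nonneg _ (by decide)) (by positivity)
    simp only [divBody, BlockTo, Instr.assign, Function.update_apply, Int.reduceNeg,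
      Int.reduceEq, if_true, if_false, e1, e2, eB, eD, hn, ha, hc, sub_ediv_two_mul_two, hS', hSB,
      hSA]
    and_intros
    all_goals try first
      | (rw [abs_le]; push_cast at *; omega)
      | omega
    · repeat refine SameOff.update ?_ (by decide)
      exact hs
    · exact ⟨i + 1, by omega, by simp, by simp⟩
  · rintro m' ⟨hs, _, i, hi, hn, ha⟩
    obtain rfl : i = J := by omega
    exact hl m' hs hn ha

end RandomAccess

/-! ### Polynomial steps on values at an even base -/

namespace ParityPoly

open Polynomial

theorem eval_normStep {B : ℕ} (hB : 2 ∣ B) {p : ℕ[X]} (h : p.coeff 0 < B) :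
    (normStep p).eval B = if p.eval B % 2 = 0 then p.eval B / B else p.eval B := by
  rw [eval_mod_two hB, normStep, eval_div h]
  split <;> rfl

theorem eval_add_mul {B : ℕ} (hB : 2 ∣ B) (p q : ℕ[X]) :
    (q + C (q.coeff 0 % 2) * p).eval B = q.eval B + q.eval B % 2 * p.eval B := by
  rw [eval_mod_two hB, eval_add, eval_mul, eval_C]

theorem eval_divStep {B : ℕ} (hB : 2 ∣ B) {p q : ℕ[X]} (a : ℕ)
    (h : (q + C (q.coeff 0 % 2) * p).coeff 0 < B) :
    (divStep p (q, a)).1.eval B = (q.eval B + q.eval B % 2 * p.eval B) / B := by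
  rw [← eval_add_mul hB, eval_div h, divStep]

theorem divStep_snd {B : ℕ} (hB : 2 ∣ B) (p q : ℕ[X]) (a : ℕ) :
    (divStep p (q, a)).2 = a + (q.eval B + q.eval B % 2 * p.eval B) % 2 := by
  rw [← eval_add_mul hB, eval_mod_two hB, divStep]

end ParityPoly

/-! ### The divisibility test as a program -/

namespace RandomAccess

open Polynomial ParityPoly

theorem leads_divStep_iterate {K : ℤ} {l : List Cmd} {m : ℤ → ℤ} {Q : (ℤ → ℤ) → Prop} {N : ℕ}
    {p q : ℕ[X]} {a B J c c' : ℕ} (h1 : m (-1) = 1) (h2 : m (-2) = 2) (hB : m (-14) = B)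
    (hJ : m (-4) = J) (hD : m (-26) = (p.eval B : ℕ)) (hN : m (-25) = (q.eval B : ℕ))
    (hA : m (-13) = a) (hB2 : 2 ∣ B) (hq : ∀ i, q.coeff i ≤ c) (hp : ∀ i, p.coeff i ≤ c')
    (hqJ : ∀ i, J ≤ i → q.coeff i = 0) (hpJ : ∀ i, J ≤ i → p.coeff i = 0) (hc : c + J * c' < B)
    (hBK : ((B ^ J : ℕ) : ℤ) ≤ K) (haK : (a + J + 1 : ℤ) ≤ K)
    (hl : ∀ m', SameOff [-4, -5, -13, -25] m m' →
      m' (-25) = (((divStep p)^[J] (q, a)).1.eval B : ℕ) →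
      m' (-13) = ((divStep p)^[J] (q, a)).2 → Leads K l m' Q N) :
    Leads K (.loop (-4) divBody :: l) m Q (J * 13 + 1 + N) := by
  -- Each step adds at most `c'` to a coefficient, so `c + J * c' < B` excludes carries throughout.
  have hco : ∀ i < J, ∀ k, (((divStep p)^[i] (q, a)).1 +
      C (((divStep p)^[i] (q, a)).1.coeff 0 % 2) * p).coeff k < B := by
    intro i hi k
    have h := coeff_add_mul_le (coeff_iterate_divStep_le hq hp a i) hp k
    have : (i + 1) * c' ≤ J * c' := Nat.mul_le_mul_right _ hi
    rw [add_mul, one_mul] at this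
    omega
  refine leads_div (Nv := fun i => ((divStep p)^[i] (q, a)).1.eval B)
    (Av := fun i => ((divStep p)^[i] (q, a)).2) h1 h2 hB hJ hD hN hA ?_ ?_ ?_ ?_ ?_
    (by omega) (by omega) hl
  · intro i hi
    simp only [Function.iterate_succ_apply']
    exact eval_divStep hB2 _ (hco i hi 0)
  · intro i hi
    simp only [Function.iterate_succ_apply']
    exact divStep_snd hB2 _ _ _
  · intro i hi
    refine le_trans (Nat.cast_le.2 (eval_lt (fun k => ?_) ?_).le) hBK
    · have h := coeff_iterate_divStep_le hq hp a i k
      have : i * c' ≤ J * c' := Nat.mul_le_mul_right _ hi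
      omega
    · exact coeff_iterate_divStep_eq_zero hqJ hpJ a i
  · intro i hi
    rw [← eval_add_mul hB2]
    refine le_trans (Nat.cast_le.2 (eval_lt (hco i hi) ?_).le) hBK
    exact coeff_add_mul_eq_zero (coeff_iterate_divStep_eq_zero hqJ hpJ a i) hpJ
  · intro i hi
    have := iterate_divStep_snd_le p q a i
    omega

/-- Decide whether the packed polynomial in register `-26` divides the one in register `-25`
modulo two, up to powers of the variable. -/
def dividesCmds : List Cmd :=
  [.block [.add (-28) (-15) (-15), .add (-28) (-28) (-1), .copy (-4) (-28)],
    .loop (-4) normBody,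
    .block [.copy (-4) (-28)],
    .loop (-4) divBody,
    .block [.const (-26) 0, .copy (-4) (-28)],
    .loop (-4) divBody,
    .block [.add (-13) (-13) (-1), .div 0 (-1) (-13)]]

open Classical in
theorem leads_divides {K : ℤ} {m : ℤ → ℤ} {p q : ℕ[X]} {a B E c : ℕ}
    (h1 : m (-1) = 1) (h2 : m (-2) = 2) (hB : m (-14) = B) (hE : m (-15) = E)
    (hD : m (-26) = (p.eval B : ℕ)) (hN : m (-25) = (q.eval B : ℕ)) (hA : m (-13) = a)
    (hB2 : 2 ∣ B) (hq : ∀ i, q.coeff i ≤ c) (hp : ∀ i, p.coeff i ≤ c)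
    (hqJ : ∀ i, 2 * E + 1 ≤ i → q.coeff i = 0) (hpJ : ∀ i, 2 * E + 1 ≤ i → p.coeff i = 0)
    (hc : c + (2 * E + 1) * c < B) (hBK : ((B ^ (2 * E + 1) : ℕ) : ℤ) ≤ K)
    (haK : (a + 4 * E + 10 : ℤ) ≤ K) :
    Leads K dividesCmds m (fun m' => m' 0 =
      if a = 0 ∧ red (normStep^[2 * E + 1] p) ∣ red q then 1 else 0) ((2 * E + 1) * 36 + 11) := by
  obtain ⟨J, hJ⟩ : ∃ J, J = 2 * E + 1 := ⟨_, rfl⟩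
  rw [← hJ] at hqJ hpJ hc hBK ⊢
  have hJ' : (E : ℤ) + E + 1 = J := by rw [hJ]; push_cast; ring
  have hcB : c < B := by omega
  have hBK' : (B : ℤ) ≤ K := by
    refine le_trans ?_ hBK
    exact_mod_cast Nat.le_self_pow (by omega) B
  refine Leads.mono (N := 3 + (J * 10 + 1 + (1 + (J * 13 + 1 + (2 + (J * 13 + 1 + (2 + 0)))))))
    ?_ (by omega)
  refine Leads.block ?_
  simp only [BlockTo, Instr.assign, Function.update_apply, Int.reduceNeg, Int.reduceEq, if_true,
    if_false, h1, hE, hJ']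
  refine ⟨by rw [abs_le]; omega, by rw [abs_le]; omega, by rw [abs_le]; omega, ?_⟩
  refine leads_norm (Dv := fun i => (normStep^[i] p).eval B) (B := B) (J := J) (by simp [h1])
    (by simp [h2]) (by simp [hB]) (by simp) (by simp [hD]) ?_ ?_ (by omega) hBK' (by omega) ?_
  · intro i _
    simp only [Function.iterate_succ_apply']
    exact eval_normStep hB2 ((coeff_iterate_normStep_le hp i 0).trans_lt hcB)
  · intro i _
    refine le_trans (Nat.cast_le.2 (eval_lt (fun k => ?_) ?_).le) hBK
    · exact (coeff_iterate_normStep_le hp i k).trans_lt hcB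
    · exact coeff_iterate_normStep_eq_zero hpJ i
  intro m₁ s₁ hD₁
  refine Leads.block ?_
  have e28 : m₁ (-28) = J := by rw [s₁ _ (by decide)]; simp
  simp only [BlockTo, Instr.assign, e28]
  refine ⟨by rw [abs_le]; omega, ?_⟩
  have hp' := coeff_iterate_normStep_le hp J
  have hpJ' := coeff_iterate_normStep_eq_zero hpJ J
  refine leads_divStep_iterate (p := normStep^[J] p) (q := q) (a := a) (B := B) (J := J) (c := c)
    (c' := c) (by simp [s₁ (-1) (by decide), h1]) (by simp [s₁ (-2) (by decide), h2])
    (by simp [s₁ (-14) (by decide), hB]) (by simp) (by simp [hD₁])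
    (by simp [s₁ (-25) (by decide), hN]) (by simp [s₁ (-13) (by decide), hA]) hB2 hq hp'
    hqJ hpJ' hc hBK (by omega) ?_
  intro m₂ s₂ hN₂ hA₂
  refine Leads.block ?_
  have f1 : m₂ (-1) = 1 := by simp [s₂ (-1) (by decide), s₁ (-1) (by decide), h1]
  have f2 : m₂ (-2) = 2 := by simp [s₂ (-2) (by decide), s₁ (-2) (by decide), h2]
  have f14 : m₂ (-14) = B := by simp [s₂ (-14) (by decide), s₁ (-14) (by decide), hB]
  have f28 : m₂ (-28) = J := by simp [s₂ (-28) (by decide), e28]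
  simp only [BlockTo, Instr.assign, Function.update_apply, Int.reduceNeg, Int.reduceEq, if_false,
    f28]
  refine ⟨by rw [abs_le]; omega, by rw [abs_le]; omega, ?_⟩
  have hA' := iterate_divStep_snd_le (normStep^[J] p) q a J
  refine leads_divStep_iterate (p := 0) (q := ((divStep (normStep^[J] p))^[J] (q, a)).1)
    (a := ((divStep (normStep^[J] p))^[J] (q, a)).2) (B := B) (J := J) (c := c + J * c)
    (c' := 0) (by simp [f1]) (by simp [f2]) (by simp [f14]) (by simp) (by simp) (by simp [hN₂])
    (by simp [hA₂]) hB2 (coeff_iterate_divStep_le hq hp' a J) (by simp)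
    (coeff_iterate_divStep_eq_zero hqJ hpJ' a J) (by simp) (by simpa using hc) hBK
    (by omega) ?_
  intro m₃ s₃ hN₃ hA₃
  have g1 : m₃ (-1) = 1 := by simp [s₃ (-1) (by decide), f1]
  rw [Prod.mk.eta] at hA₃
  have hA'' := iterate_divStep_snd_le 0 ((divStep (normStep^[J] p))^[J] (q, a)).1
    ((divStep (normStep^[J] p))^[J] (q, a)).2 J
  rw [Prod.mk.eta] at hA''
  have hkey := iterate_divStep_eq_zero_iff_dvd (iterate_normStep_eq_zero_or hpJ) hpJ' hqJ a
  generalize ((divStep 0)^[J] ((divStep (normStep^[J] p))^[J] (q, a))).2 = A at hA₃ hA'' hkey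
  refine Leads.block (N := 0) ?_
  simp only [BlockTo, Instr.assign, Function.update_apply, Int.reduceNeg, Int.reduceEq, if_true,
    if_false, g1, hA₃]
  -- The quotient `1 / (A + 1)` turns the counter into the answer: it is `1` for `A = 0` and `0` for
  -- `A > 0`.
  have hfin : (1 : ℤ) / (A + 1) = if a = 0 ∧ red (normStep^[J] p) ∣ red q then 1 else 0 := by
    by_cases hA0 : A = 0
    · rw [if_pos (hkey.1 hA0), hA0]; rfl
    · rw [if_neg fun h => hA0 (hkey.2 h)]
      exact Int.ediv_eq_zero_of_lt (by omega) (by omega)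
  rw [hfin]
  refine ⟨by rw [abs_le]; omega, ?_, Leads.nil (by simp)⟩
  split <;> simp <;> omega

/-! ### Fixed registers, exponent offsets and size bounds -/

/-- Registers that keep their contents throughout. -/
structure Consts (w : EqWord) (m : ℤ → ℤ) : Prop where
  one : m (-1) = 1
  two : m (-2) = 2
  three : m (-9) = 3
  six : m (-10) = 6
  table : m (-24) = -20
  length : m 0 = w.length
  input : ∀ i, 1 ≤ i → m i = w.inputMemory i

theorem Consts.of_sameOff {w : EqWord} {m m' : ℤ → ℤ} {R : List ℤ} (h : Consts w m)
    (hs : SameOff R m m') (h1 : ∀ r ∈ [-1, -2, -9, -10, -24, 0], r ∉ R) (h2 : ∀ r ∈ R, r < 0) :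
    Consts w m' where
  one := by rw [hs _ (h1 _ (by simp)), h.one]
  two := by rw [hs _ (h1 _ (by simp)), h.two]
  three := by rw [hs _ (h1 _ (by simp)), h.three]
  six := by rw [hs _ (h1 _ (by simp)), h.six]
  table := by rw [hs _ (h1 _ (by simp)), h.table]
  length := by rw [hs _ (h1 _ (by simp)), h.length]
  input i hi := by
    rw [hs _ fun hr => absurd (h2 i hr) (by omega), h.input i hi]

theorem Consts.update {w : EqWord} {m : ℤ → ℤ} (h : Consts w m) {d v : ℤ}
    (h1 : ∀ r ∈ [-1, -2, -9, -10, -24, 0], r ∉ [d]) (h2 : ∀ r ∈ [d], r < 0) :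
    Consts w (Function.update m d v) :=
  h.of_sameOff ((SameOff.refl [d] m).update (by simp)) h1 h2

/-- The exponent by which a letter changes the power of the base, shifted by the length `n`. -/
def letterExp (n : ℕ) (δ : ℤ) (y : EqGen) (b : Bool) : ℕ := (n - EqWord.posAt δ [(y, b)]).toNat

/-- The exponent of the base that stands for the position after a word, shifted by `n * n`. -/
def wordExp (n : ℕ) (δ : ℤ) (w : EqWord) : ℕ := (((n * n : ℕ) : ℤ) - EqWord.posAt δ w).toNat

theorem posAt_cons (δ : ℤ) (y : EqGen) (b : Bool) (u : EqWord) :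
    EqWord.posAt δ ((y, b) :: u) = EqWord.posAt δ [(y, b)] + EqWord.posAt δ u := by
  cases y <;> simp [EqWord.posAt]

theorem abs_posAt_le_mul {n : ℕ} {δ : ℤ} (hn : 1 ≤ n) (hδ : |δ| ≤ n) {u : EqWord}
    (hu : u.length ≤ n) : |EqWord.posAt δ u| ≤ (n * n : ℕ) :=
  (EqWord.abs_posAt_le hn hδ u).trans (by exact_mod_cast Nat.mul_le_mul_right _ hu)

theorem cast_wordExp {n : ℕ} {δ : ℤ} (hn : 1 ≤ n) (hδ : |δ| ≤ n) (u : EqWord)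
    (hu : u.length ≤ n) : (wordExp n δ u : ℤ) = ((n * n : ℕ) : ℤ) - EqWord.posAt δ u := by
  have := abs_posAt_le_mul hn hδ hu
  rw [abs_le] at this
  rw [wordExp, Int.toNat_of_nonneg (by omega)]

theorem wordExp_le {n : ℕ} {δ : ℤ} (hn : 1 ≤ n) (hδ : |δ| ≤ n) (u : EqWord)
    (hu : u.length ≤ n) : wordExp n δ u ≤ 2 * (n * n) := by
  have h := abs_posAt_le_mul hn hδ hu
  have h' := cast_wordExp hn hδ u hu
  rw [abs_le] at h
  omega

theorem cast_letterExp {n : ℕ} {δ : ℤ} (hn : 1 ≤ n) (hδ : |δ| ≤ n) (y : EqGen) (b : Bool) :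
    (letterExp n δ y b : ℤ) = n - EqWord.posAt δ [(y, b)] ∧ letterExp n δ y b ≤ 2 * n := by
  have h := EqWord.abs_posAt_le hn hδ [(y, b)]
  rw [List.length_singleton, one_mul, abs_le] at h
  rw [letterExp]
  omega

/-- The letter `a` does not move, so its exponent is the bare offset `n`; dividing by its power
restores the offset `n * n` of the word. -/
theorem pow_wordExp_cons {n : ℕ} {δ : ℤ} (hn : 1 ≤ n) (hδ : |δ| ≤ n) {B : ℕ} (hB : 1 ≤ B)
    (y : EqGen) (b : Bool) (u : EqWord) (hu : ((y, b) :: u).length ≤ n) :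
    B ^ wordExp n δ u * B ^ letterExp n δ y b / B ^ letterExp n δ EqGen.a true =
      B ^ wordExp n δ ((y, b) :: u) := by
  have h1 := cast_wordExp hn hδ _ hu
  have h2 := cast_wordExp hn hδ u (by rw [List.length_cons] at hu; omega)
  have h3 := (cast_letterExp hn hδ y b).1
  have h4 := (cast_letterExp hn hδ EqGen.a true).1
  rw [posAt_cons] at h1
  have h5 : EqWord.posAt δ [(EqGen.a, true)] = 0 := rfl
  rw [← pow_add, Nat.pow_div (by omega) (by omega)]
  congr 1
  omega

/-- The largest power of the base that the program computes. -/
def memBound (n : ℕ) : ℕ := (6 * n ^ 3) ^ (2 * n ^ 2 + 2 * n + 1)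

theorem pow_le_memBound {n k : ℕ} (hn : 1 ≤ n) (hk : k ≤ 2 * (n * n) + 2 * n + 1) :
    (n * n * n * 6) ^ k ≤ memBound n := by
  rw [memBound, show n * n * n * 6 = 6 * n ^ 3 by ring]
  refine Nat.pow_le_pow_right (by positivity) (by rw [sq]; omega)

theorem small_le_memBound {n : ℕ} (hn : 1 ≤ n) : 100 * n ^ 4 ≤ memBound n := by
  refine le_trans ?_ (pow_le_memBound (k := 4) hn (by nlinarith))
  have h1 : n * n * n * 6 = 6 * n ^ 3 := by ring
  rw [h1, mul_pow, ← pow_mul]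
  exact Nat.mul_le_mul (by norm_num) (Nat.pow_le_pow_right hn (by norm_num))

theorem size_memBound_le {n : ℕ} (hn : 1 ≤ n) {x : ℕ} (hx : x ≤ memBound n) :
    x.size ≤ (n + 2) ^ 7 := by
  rw [Nat.size_le]
  have h1 : 6 * n ^ 3 ≤ 2 ^ (3 * n + 3) := by
    have : n < 2 ^ n := Nat.lt_two_pow_self
    calc 6 * n ^ 3 ≤ 8 * (2 ^ n) ^ 3 := Nat.mul_le_mul (by norm_num) (Nat.pow_le_pow_left this.le 3)
      _ = 2 ^ (3 * n + 3) := by rw [pow_add, ← pow_mul, mul_comm n 3]; ring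
  have h2 : memBound n ≤ 2 ^ ((3 * n + 3) * (2 * n ^ 2 + 2 * n + 1)) := by
    rw [memBound, pow_mul 2]
    exact Nat.pow_le_pow_left h1 _
  -- The exponent of `2` is cubic in `n`; its constant factor `6` is absorbed by `3 ^ 4 ≤ (n + 2) ^
  -- 4`, which gives the exponent `7`.
  refine (hx.trans h2).trans_lt (Nat.pow_lt_pow_right (by norm_num) ?_)
  have h3 : (3 * n + 3) * (2 * n ^ 2 + 2 * n + 1) < (n + 2) ^ 3 * 6 + 1 := by nlinarith
  have h4 : (n + 2) ^ 3 * 3 ^ 4 ≤ (n + 2) ^ 3 * (n + 2) ^ 4 :=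
    Nat.mul_le_mul_left _ (Nat.pow_le_pow_left (by omega) 4)
  have h5 : 0 < (n + 2) ^ 3 := by positivity
  calc _ < (n + 2) ^ 3 * 6 + 1 := h3
    _ ≤ (n + 2) ^ 3 * 3 ^ 4 := by omega
    _ ≤ (n + 2) ^ 3 * (n + 2) ^ 4 := h4
    _ = (n + 2) ^ 7 := by ring

theorem solvable_iff_red_dvd {w : EqWord} (hw : w.sigmaX ≠ 0) {n : ℕ} (hn : w.length = n)
    (hn1 : 1 ≤ n) {δ : ℤ} (hδ : |δ| ≤ n) (hδ' : δ = (-EqWord.posAt 0 w) / w.sigmaX) :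
    w.Solvable ↔ δ * w.sigmaX + EqWord.posAt 0 w = 0 ∧
      red (normStep^[2 * (n * n) + 1] (EqWord.denPoly (wordExp n δ) w)) ∣
        red (EqWord.numPoly (wordExp n δ) w) := by
  have ht : w.tw = EqWord.posAt 0 w := by rw [← EqWord.tw_add_xw_mul, mul_zero, add_zero]
  rw [EqWord.solvable_iff, ht, EqWord.xw_eq_sigmaX]
  have hdvd : w.den δ ∣ w.num δ ↔
      red (normStep^[2 * (n * n) + 1] (EqWord.denPoly (wordExp n δ) w)) ∣
        red (EqWord.numPoly (wordExp n δ) w) := by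
    rw [← toLaurent_red_dvd_iff, EqWord.toLaurent_red_denPoly (cast_wordExp hn1 hδ) w hn.le,
      EqWord.toLaurent_red_numPoly (cast_wordExp hn1 hδ) w hn.le,
      (LaurentPolynomial.isUnit_T _).mul_left_dvd, (LaurentPolynomial.isUnit_T _).dvd_mul_left]
    intro i hi
    refine EqWord.coeff_denPoly_eq_zero (n := n) (fun v hv => ?_) w hn.le
    have := wordExp_le hn1 hδ v hv
    omega
  rw [← hdvd]
  constructor
  · rintro ⟨d, h1, h2⟩
    -- An exact solution agrees with the integer quotient, so only this one `δ` has to be tested.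
    have : d = δ := by
      rw [hδ', show -EqWord.posAt 0 w = d * w.sigmaX by linarith, Int.mul_ediv_cancel _ hw]
    subst this
    exact ⟨by linarith, h2⟩
  · rintro ⟨h1, h2⟩
    exact ⟨δ, by linarith, h2⟩

theorem SameOff.mono {R R' : List ℤ} {m m' : ℤ → ℤ} (h : SameOff R m m') (hR : ∀ r ∈ R, r ∈ R') :
    SameOff R' m m' :=
  fun i hi => h i fun hi' => hi (hR i hi')

theorem SameOff.trans {R : List ℤ} {m m' m'' : ℤ → ℤ} (h : SameOff R m m')
    (h' : SameOff R m' m'') : SameOff R m m'' :=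
  fun i hi => (h' i hi).trans (h i hi)

/-- Keeps `δ` within the bounds of the program even if the division is inexact and the answer will
be negative. -/
theorem abs_ediv_le {s t : ℤ} {n : ℕ} (ht : |t| ≤ n) : |t / s| ≤ n := by
  have h : |t / s| ≤ |t| := by
    rw [Int.abs_eq_natAbs, Int.abs_eq_natAbs]
    exact_mod_cast Int.natAbs_ediv_le_natAbs t s
  exact h.trans ht

/-! ### The complete program -/

/-- Compute the powers of the base for the offset and for the letters. -/
def powerCmds : List Cmd :=
  [powLoop (-16),
    .block [.const (-19) 1, .copy (-4) 0],
    powLoop (-19),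
    .block [.const (-17) 1, .sub (-4) 0 (-12)],
    powLoop (-17),
    .block [.const (-23) 1, .add (-4) 0 (-12)],
    powLoop (-23),
    .block [.copy (-21) (-19), .div (-18) (-19) (-14), .mul (-22) (-19) (-14), .copy (-4) 0]]

theorem leads_powers {K : ℤ} {l : List Cmd} {m₂ : ℤ → ℤ} {Q : (ℤ → ℤ) → Prop} {N : ℕ}
    {w : EqWord} {n S B x₁ x₂ : ℕ} {δ : ℤ} (c₂ : Consts w m₂) (hn : w.length = n) (hn1 : 1 ≤ n)
    (q4 : m₂ (-4) = S) (q12 : m₂ (-12) = δ) (q14 : m₂ (-14) = B) (q16 : m₂ (-16) = 1)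
    (hx1 : (x₁ : ℤ) = n - δ) (hx2 : (x₂ : ℤ) = n + δ) (hB1 : 1 ≤ B)
    (hpow : ∀ k, k ≤ 2 * S + 2 * n + 1 → ((B ^ k : ℕ) : ℤ) ≤ K) (hSK : (S + 3 * n : ℤ) ≤ K)
    (hl : ∀ m', SameOff [-4, -16, -17, -18, -19, -21, -22, -23] m₂ m' → m' (-4) = n →
      m' (-16) = ((B ^ S : ℕ) : ℤ) → m' (-17) = ((B ^ x₁ : ℕ) : ℤ) →
      m' (-18) = ((B ^ (n - 1) : ℕ) : ℤ) → m' (-19) = ((B ^ n : ℕ) : ℤ) →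
      m' (-21) = ((B ^ n : ℕ) : ℤ) → m' (-22) = ((B ^ (n + 1) : ℕ) : ℤ) →
      m' (-23) = ((B ^ x₂ : ℕ) : ℤ) → Leads K l m' Q N) :
    Leads K (powerCmds ++ l) m₂ Q (S * 4 + 1 + (2 + (n * 4 + 1 + (2 + (x₁ * 4 + 1 +
      (2 + (x₂ * 4 + 1 + (4 + N)))))))) := by
  rw [powerCmds]
  simp only [List.cons_append, List.nil_append]
  refine leads_powLoop (by decide) c₂.one q14 q4 q16 (hpow _ (by omega)) (by omega) hB1 ?_
  intro m₃ s₃ q16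
  have c₃ := c₂.of_sameOff s₃ (by decide) (by decide)
  have l₃ := c₃.length
  rw [hn] at l₃
  refine Leads.block_of (R := fun m => SameOff [-4, -19] m₃ m ∧ m (-4) = n ∧ m (-19) = 1) ?_ ?_
  · simp only [BlockTo, Instr.assign, Function.update_apply, Int.reduceNeg, zero_eq_neg,
      OfNat.ofNat_ne_zero, if_false, l₃]
    and_intros
    iterate 2 rw [abs_le]; omega
    · repeat refine SameOff.update ?_ (by decide)
      exact SameOff.refl _ _
    all_goals simp
  rintro m₄ ⟨s₄, q4, q19⟩
  have c₄ := c₃.of_sameOff s₄ (by decide) (by decide)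
  refine leads_powLoop (B := B) (by decide) c₄.one
    (by rw [s₄ _ (by decide), s₃ _ (by decide), q14]) q4 q19 (hpow _ (by omega)) (by omega) hB1 ?_
  intro m₅ s₅ q19
  have c₅ := c₄.of_sameOff s₅ (by decide) (by decide)
  have l₅ := c₅.length
  rw [hn] at l₅
  have p12 : m₅ (-12) = δ := by
    rw [s₅ _ (by decide), s₄ _ (by decide), s₃ _ (by decide), q12]
  refine Leads.block_of (R := fun m => SameOff [-4, -17] m₅ m ∧ m (-4) = x₁ ∧ m (-17) = 1) ?_ ?_
  · simp only [BlockTo, Instr.assign, Function.update_apply, Int.reduceNeg, Int.reduceEq,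
      zero_eq_neg, OfNat.ofNat_ne_zero, if_false, l₅, p12]
    and_intros
    iterate 2 rw [abs_le]; omega
    · repeat refine SameOff.update ?_ (by decide)
      exact SameOff.refl _ _
    all_goals simp [hx1]
  rintro m₆ ⟨s₆, q4, q17⟩
  have c₆ := c₅.of_sameOff s₆ (by decide) (by decide)
  have p14 : m₆ (-14) = B := by
    rw [s₆ _ (by decide), s₅ _ (by decide), s₄ _ (by decide), s₃ _ (by decide), q14]
  refine leads_powLoop (B := B) (by decide) c₆.one p14 q4 q17 (hpow _ (by omega)) (by omega)
    hB1 ?_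
  intro m₇ s₇ q17
  have c₇ := c₆.of_sameOff s₇ (by decide) (by decide)
  have l₇ := c₇.length
  rw [hn] at l₇
  have p12 : m₇ (-12) = δ := by
    rw [s₇ _ (by decide), s₆ _ (by decide), p12]
  refine Leads.block_of (R := fun m => SameOff [-4, -23] m₇ m ∧ m (-4) = x₂ ∧ m (-23) = 1) ?_ ?_
  · simp only [BlockTo, Instr.assign, Function.update_apply, Int.reduceNeg, Int.reduceEq,
      zero_eq_neg, OfNat.ofNat_ne_zero, if_false, l₇, p12]
    and_intros
    iterate 2 rw [abs_le]; omega
    · repeat refine SameOff.update ?_ (by decide)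
      exact SameOff.refl _ _
    all_goals simp [hx2]
  rintro m₈ ⟨s₈, q4, q23⟩
  have c₈ := c₇.of_sameOff s₈ (by decide) (by decide)
  have p14 : m₈ (-14) = B := by rw [s₈ _ (by decide), s₇ _ (by decide), p14]
  refine leads_powLoop (B := B) (by decide) c₈.one p14 q4 q23 (hpow _ (by omega)) (by omega)
    hB1 ?_
  intro m₉ s₉ q23
  have c₉ := c₈.of_sameOff s₉ (by decide) (by decide)
  have l₉ := c₉.length
  rw [hn] at l₉
  have p14 : m₉ (-14) = B := by rw [s₉ _ (by decide), p14]
  have p19 : m₉ (-19) = ((B ^ n : ℕ) : ℤ) := by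
    rw [s₉ _ (by decide), s₈ _ (by decide), s₇ _ (by decide), s₆ _ (by decide), q19]
  have hdivB : ((B ^ n : ℕ) : ℤ) / B = ((B ^ (n - 1) : ℕ) : ℤ) := by
    have h : B ^ n / B = B ^ (n - 1) :=
      Nat.div_eq_of_eq_mul_left hB1 (by rw [← pow_succ, Nat.sub_add_cancel hn1])
    rw [← h]
    norm_cast
  have hmulB : ((B ^ n : ℕ) : ℤ) * B = ((B ^ (n + 1) : ℕ) : ℤ) := by rw [pow_succ]; push_cast; rfl
  have b0 := hpow n (by omega)
  have b1 := hpow (n - 1) (by omega)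
  have b2 := hpow (n + 1) (by omega)
  refine Leads.block_of (R := fun m => SameOff [-4, -18, -21, -22] m₉ m ∧ m (-4) = n ∧
    m (-18) = ((B ^ (n - 1) : ℕ) : ℤ) ∧ m (-21) = ((B ^ n : ℕ) : ℤ) ∧
    m (-22) = ((B ^ (n + 1) : ℕ) : ℤ)) ?_ ?_
  · simp only [BlockTo, Instr.assign, Function.update_apply, Int.reduceNeg, Int.reduceEq,
      zero_eq_neg, OfNat.ofNat_ne_zero, if_false, l₉, p14, p19, hdivB, hmulB]
    and_intros
    · rwa [Nat.abs_cast]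
    · rwa [Nat.abs_cast]
    · rwa [Nat.abs_cast]
    · rw [Nat.abs_cast]; omega
    · repeat refine SameOff.update ?_ (by decide)
      exact SameOff.refl _ _
    all_goals rfl
  rintro m' ⟨s₁₀, r4, r18, r21, r22⟩
  refine hl m' ?_ r4 ?_ ?_ r18 ?_ r21 r22 ?_
  · have h := fun R m m' (h : SameOff R m m') (h' : ∀ r ∈ R, r ∈ [-4, -16, -17, -18, -19, -21,
      -22, (-23 : ℤ)]) => h.mono h'
    exact (h _ _ _ s₃ (by decide)).trans <| (h _ _ _ s₄ (by decide)).trans <|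
      (h _ _ _ s₅ (by decide)).trans <| (h _ _ _ s₆ (by decide)).trans <|
      (h _ _ _ s₇ (by decide)).trans <| (h _ _ _ s₈ (by decide)).trans <|
      (h _ _ _ s₉ (by decide)).trans (h _ _ _ s₁₀ (by decide))
  · rw [s₁₀ _ (by decide), s₉ _ (by decide), s₈ _ (by decide), s₇ _ (by decide),
      s₆ _ (by decide), s₅ _ (by decide), s₄ _ (by decide), q16]
  · rw [s₁₀ _ (by decide), s₉ _ (by decide), s₈ _ (by decide), q17]
  · rw [s₁₀ _ (by decide), p19]
  · rw [s₁₀ _ (by decide), q23]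

/-- The program that decides solvability of the equations with nonzero exponent sum of `x`. -/
def equationCmds : List Cmd :=
  [.block [.const (-1) 1, .const (-2) 2, .const (-9) 3, .const (-10) 6, .const (-24) (-20),
      .copy (-4) 0],
    .loop (-4) scanBody,
    .block [.const (-5) 0, .sub (-5) (-5) (-8), .div (-12) (-5) (-7), .mul (-5) (-12) (-7),
      .add (-5) (-5) (-8), .mul (-13) (-5) (-5), .mul (-15) 0 0, .mul (-14) (-15) 0,
      .mul (-14) (-14) (-10), .const (-16) 1, .copy (-4) (-15)]] ++
    (powerCmds ++ .loop (-4) letterBody :: dividesCmds)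

open Classical in
theorem leads_equation {w : EqWord} (hw : w.sigmaX ≠ 0) :
    Leads (memBound w.length) equationCmds w.inputMemory
      (fun m' => m' 0 = if w.Solvable then 1 else 0)
      (76 * w.length ^ 2 + 51 * w.length + 80) := by
  obtain ⟨n, hn⟩ : ∃ n, w.length = n := ⟨_, rfl⟩
  have hn1 : 1 ≤ n := by
    rw [← hn]
    cases w with
    | nil => exact absurd rfl hw
    | cons y w => simp
  obtain ⟨S, hS⟩ : ∃ S : ℕ, S = n * n := ⟨_, rfl⟩
  have hSz : (n : ℤ) * n = S := by rw [hS]; push_cast; rfl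
  obtain ⟨s, hs⟩ : ∃ s, w.sigmaX = s := ⟨_, rfl⟩
  obtain ⟨t, ht⟩ : ∃ t, EqWord.posAt 0 w = t := ⟨_, rfl⟩
  have hsn : |s| ≤ n := by rw [← hs, ← hn]; exact abs_sigmaX_le w
  have htn : |t| ≤ n := by
    have := EqWord.abs_posAt_le (δ := 0) le_rfl (by simp) w
    rwa [ht, mul_one, hn] at this
  obtain ⟨δ, hδ⟩ : ∃ δ, δ = -t / s := ⟨_, rfl⟩
  have hδn : |δ| ≤ n := by rw [hδ]; exact abs_ediv_le (by rwa [abs_neg])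
  have hsol := solvable_iff_red_dvd hw hn hn1 hδn (by rw [hδ, ht, hs])
  rw [hs, ht] at hsol
  obtain ⟨r, hr⟩ : ∃ r, r = δ * s := ⟨_, rfl⟩
  rw [← hr] at hsol
  have hrn : |r| ≤ n * n := by
    rw [hr, abs_mul]; exact mul_le_mul hδn hsn (abs_nonneg _) (by positivity)
  have hn2 : (n : ℤ) ≤ n * n := by exact_mod_cast Nat.le_mul_self n
  have hrt : |r + t| ≤ 2 * (n * n) := (abs_add_le _ _).trans (by omega)
  have hrr : (r + t) * (r + t) ≤ 4 * n ^ 4 := by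
    have := mul_le_mul hrt hrt (abs_nonneg _) (by positivity)
    rw [abs_mul_abs_self] at this
    calc _ ≤ _ := this
      _ = _ := by ring
  -- The counter of the division loop starts at the square of `δ * s + t`. It is a natural number
  -- that vanishes exactly if the division was exact, so the final test covers integrality as well.
  obtain ⟨a, ha⟩ : ∃ a : ℕ, (a : ℤ) = (r + t) * (r + t) :=
    ⟨((r + t) * (r + t)).toNat, Int.toNat_of_nonneg (mul_self_nonneg _)⟩
  have ha0 : a = 0 ↔ r + t = 0 := by
    rw [← mul_self_eq_zero (a := r + t), ← ha, Nat.cast_eq_zero]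
  obtain ⟨B, hB⟩ : ∃ B, B = n * n * n * 6 := ⟨_, rfl⟩
  have hBz : (n : ℤ) * n * n * 6 = B := by rw [hB]; push_cast; rfl
  have hB1 : 1 ≤ B := by rw [hB]; exact Nat.mul_pos (by positivity) (by norm_num)
  obtain ⟨K, hK⟩ : ∃ K : ℤ, K = memBound n := ⟨_, rfl⟩
  have hpow : ∀ k, k ≤ 2 * (n * n) + 2 * n + 1 → ((B ^ k : ℕ) : ℤ) ≤ K := by
    intro k hk
    rw [hK, hB]
    exact_mod_cast pow_le_memBound hn1 hk
  have hsmall : 100 * (n : ℤ) ^ 4 ≤ K := by rw [hK]; exact_mod_cast small_le_memBound hn1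
  have hn4 : (n : ℤ) * n ≤ n ^ 4 := by
    have : n ^ 2 ≤ n ^ 4 := Nat.pow_le_pow_right hn1 (by norm_num)
    rw [← sq]; exact_mod_cast this
  have hBK : (B : ℤ) ≤ K := by simpa using hpow 1 (by omega)
  have hSn : (S : ℤ) * n ≤ K := by
    have : (0 : ℤ) ≤ S * n := by positivity
    rw [hSz] at hBz
    omega
  -- Coefficients are at most `n` initially and grow by at most `n` in each of `2n² + 1` steps; `2n³
  -- + 2n < 6n³`. The factor `6` also makes the base even.
  have hc : n + (2 * (n * n) + 1) * n < B := by
    rw [hB]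
    have : n * 1 ≤ n * (n * n) := Nat.mul_le_mul_left _ (Nat.mul_pos hn1 hn1)
    nlinarith
  have e1 := wordExp_le hn1 hδn
  have e2 := fun y b => cast_letterExp hn1 hδn y b
  rw [← hS] at hsol hc
  simp only [← hS] at hpow e1
  rw [hSz] at hrn hn2 hrt hn4 hBz
  have hδ2 := abs_le.1 hδn
  have ht2 := abs_le.1 htn
  have hs2 := abs_le.1 hsn
  have hr2 := abs_le.1 hrn
  have hrt2 := abs_le.1 hrt
  have hx1 : (((n - δ).toNat : ℕ) : ℤ) = n - δ := Int.toNat_of_nonneg (by omega)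
  have hx2 : (((n + δ).toNat : ℕ) : ℤ) = n + δ := Int.toNat_of_nonneg (by omega)
  obtain ⟨x₁, hx₁⟩ : ∃ x, x = (n - δ).toNat := ⟨_, rfl⟩
  obtain ⟨x₂, hx₂⟩ : ∃ x, x = (n + δ).toNat := ⟨_, rfl⟩
  rw [← hx₁] at hx1
  rw [← hx₂] at hx2
  rw [hn, ← hK]
  -- One summand per block or loop. With `x₁ + x₂ = 2n` they add up to exactly `76n² + 51n + 80`.
  refine Leads.mono (N := 6 + (n * 16 + 1 + (11 + (S * 4 + 1 + (2 + (n * 4 + 1 +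
    (2 + (x₁ * 4 + 1 + (2 + (x₂ * 4 + 1 + (4 + (n * 23 + 1 + ((2 * S + 1) * 36 + 11)))))))))))))
    ?_ (by rw [sq, ← hS]; omega)
  rw [equationCmds]
  simp only [List.cons_append, List.nil_append]
  have hin0 : w.inputMemory 0 = n := by simp [EqWord.inputMemory, hn]
  -- Negative registers start at zero, so the accumulators in `-7`, `-8`, `-25` and `-26` need no
  -- initialisation.
  have hneg : ∀ i < 0, w.inputMemory i = 0 := by
    intro i hi
    rw [EqWord.inputMemory, if_neg (by omega), if_neg (by omega)]
  refine Leads.block_of (R := fun m => SameOff [-1, -2, -4, -9, -10, -24] w.inputMemory m ∧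
    m (-1) = 1 ∧ m (-2) = 2 ∧ m (-9) = 3 ∧ m (-10) = 6 ∧ m (-24) = -20 ∧ m (-4) = n) ?_ ?_
  · simp only [BlockTo, Instr.assign, Function.update_apply, Int.reduceNeg, zero_eq_neg,
      OfNat.ofNat_ne_zero, one_ne_zero, if_false, hin0]
    and_intros
    iterate 6 rw [abs_le]; omega
    · repeat refine SameOff.update ?_ (by decide)
      exact SameOff.refl _ _
    all_goals simp
  rintro m ⟨hm0, m1, m2, m9, m10, m24, hm4⟩
  have c₀ : Consts w m := by
    refine ⟨m1, m2, m9, m10, m24, ?_, ?_⟩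
    · rw [hm0 _ (by decide), hin0, hn]
    · intro i hi
      rw [hm0 _ (by simp; omega)]
  have z : ∀ i < 0, i ∉ [-1, -2, -4, -9, -10, -24] → m i = 0 := fun i hi hi' => by
    rw [hm0 _ hi', hneg _ hi]
  rw [← hn]
  refine leads_scan c₀.one c₀.two c₀.three c₀.six (by rw [hm4, hn]) (z _ (by decide) (by decide))
    (z _ (by decide) (by decide)) c₀.input
    (by rw [hn]; omega) ?_
  intro m₁ s₁ hs₁ ht₁
  rw [hs] at hs₁
  rw [ht] at ht₁
  have c₁ := c₀.of_sameOff s₁ (by decide) (by decide)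
  have l₁ := c₁.length
  rw [hn] at l₁ ⊢
  refine Leads.block_of (R := fun m => SameOff [-4, -5, -12, -13, -14, -15, -16] m₁ m ∧
    m (-4) = S ∧ m (-12) = δ ∧ m (-13) = a ∧ m (-14) = B ∧ m (-15) = S ∧ m (-16) = 1) ?_ ?_
  · simp only [BlockTo, Instr.assign, Function.update_apply, Int.reduceNeg, Int.reduceEq, if_true,
      if_false, zero_eq_neg, OfNat.ofNat_ne_zero, l₁, c₁.six, hs₁, ht₁, zero_sub, ← hδ,
      ← hr, ← ha, hSz, hBz]
    and_intros
    iterate 11 rw [abs_le]; omega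
    · repeat refine SameOff.update ?_ (by decide)
      exact SameOff.refl _ _
    all_goals first | rfl | trivial
  rintro m₂ ⟨s₂, q4, q12, q13, q14, q15, q16⟩
  have c₂ := c₁.of_sameOff s₂ (by decide) (by decide)
  refine leads_powers c₂ hn hn1 q4 q12 q14 q16 hx1 hx2 hB1 hpow (by omega) ?_
  intro m₃ s₃ r4 r16 r17 r18 r19 r21 r22 r23
  have c₃ := c₂.of_sameOff s₃ (by decide) (by decide)
  have t25 : m₃ (-25) = 0 := by
    rw [s₃ _ (by decide), s₂ _ (by decide), s₁ _ (by decide), z _ (by decide) (by decide)]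
  have t26 : m₃ (-26) = 0 := by
    rw [s₃ _ (by decide), s₂ _ (by decide), s₁ _ (by decide), z _ (by decide) (by decide)]
  have hcn : ∀ u : EqWord, u.length ≤ n → ∀ i,
      (EqWord.numPoly (wordExp n δ) u).coeff i ≤ n := fun u hu i =>
    (EqWord.coeff_numPoly_le _ u i).trans hu
  have hcd : ∀ u : EqWord, u.length ≤ n → ∀ i,
      (EqWord.denPoly (wordExp n δ) u).coeff i ≤ n := fun u hu i =>
    (EqWord.coeff_denPoly_le _ u i).trans hu
  have hzn : ∀ u : EqWord, u.length ≤ n → ∀ i, 2 * S + 1 ≤ i →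
      (EqWord.numPoly (wordExp n δ) u).coeff i = 0 := fun u hu i hi =>
    EqWord.coeff_numPoly_eq_zero (fun v hv => (Nat.lt_succ_of_le (e1 v hv)).trans_le hi) u hu
  have hzd : ∀ u : EqWord, u.length ≤ n → ∀ i, 2 * S + 1 ≤ i →
      (EqWord.denPoly (wordExp n δ) u).coeff i = 0 := fun u hu i hi =>
    EqWord.coeff_denPoly_eq_zero (fun v hv => (Nat.lt_succ_of_le (e1 v hv)).trans_le hi) u hu
  have hnB : n < B := by omega
  have hBL := hpow (2 * S + 1) (by omega)
  rw [← hn] at r4 ⊢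
  refine leads_letters (Nv := fun u => (EqWord.numPoly (wordExp n δ) u).eval B)
    (Dv := fun u => (EqWord.denPoly (wordExp n δ) u).eval B) (Qv := fun u => B ^ wordExp n δ u)
    (Fv := fun y b => B ^ letterExp n δ y b) c₃.one c₃.two c₃.three c₃.six c₃.table r4
    (by simp [t25, EqWord.numPoly]) (by simp [t26, EqWord.denPoly]) ?_ c₃.input ?_ ?_
    (fun b u => by simp [EqWord.numPoly]) (fun b u => by simp [EqWord.numPoly])
    (fun b u => by simp [EqWord.numPoly]) (fun b u => by simp [EqWord.denPoly])
    (fun b u => by simp [EqWord.denPoly]) (fun u => by simp [EqWord.denPoly])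
    (fun u => by simp [EqWord.denPoly]) ?_ ?_ ?_ ?_ ?_ (by omega) ?_
  · have h0 : wordExp n δ [] = S := by
      rw [wordExp, EqWord.posAt, sub_zero, Int.toNat_natCast, hS]
    rw [r16, h0]
  · have hx : letterExp n δ EqGen.x true = x₁ := by
      simp [letterExp, EqWord.posAt, EqWord.expo, hx₁]
    have hx' : letterExp n δ EqGen.x false = x₂ := by
      simp [letterExp, EqWord.posAt, EqWord.expo, hx₂]
    have ht : letterExp n δ EqGen.t true = n - 1 := by
      simp [letterExp, EqWord.posAt, EqWord.expo]
    have ht' : letterExp n δ EqGen.t false = n + 1 := by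
      simp [letterExp, EqWord.posAt, EqWord.expo]
    have hA : ∀ b, letterExp n δ EqGen.a b = n := by
      simp [letterExp, EqWord.posAt]
    intro y b
    rcases y with _ | _ | _ <;> rcases b with _ | _
    · rw [hA]; exact r21
    · rw [hA]; exact r19
    · rw [ht']; exact r22
    · rw [ht]; exact r18
    · rw [hx']; exact r23
    · rw [hx]; exact r17
  · intro y b u hu
    exact pow_wordExp_cons hn1 hδn hB1 y b u (hu.trans hn.le)
  · intro u hu
    exact le_trans (Nat.cast_le.2 (eval_lt (fun i => (hcn u (hu.trans hn.le) i).trans_lt hnB)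
      (hzn u (hu.trans hn.le))).le) hBL
  · intro u hu
    exact le_trans (Nat.cast_le.2 (eval_lt (fun i => (hcd u (hu.trans hn.le) i).trans_lt hnB)
      (hzd u (hu.trans hn.le))).le) hBL
  · intro u hu
    have := e1 u (hu.trans hn.le)
    exact hpow _ (by omega)
  · intro y b
    have := (e2 y b).2
    exact hpow _ (by omega)
  · intro y b u hu
    have h1 := (e2 y b).2
    have h2 := e1 u (hu.trans hn.le)
    have h3 := hpow (wordExp n δ u + letterExp n δ y b) (by omega)
    rw [pow_add] at h3
    exact_mod_cast h3
  intro m₄ s₄ hn₄ hd₄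
  have c₄ := c₃.of_sameOff s₄ (by decide) (by decide)
  have k14 : m₄ (-14) = B := by rw [s₄ _ (by decide), s₃ _ (by decide), q14]
  have k15 : m₄ (-15) = S := by rw [s₄ _ (by decide), s₃ _ (by decide), q15]
  have k13 : m₄ (-13) = a := by rw [s₄ _ (by decide), s₃ _ (by decide), q13]
  have hfinal := leads_divides (K := K) c₄.one c₄.two k14 k15 hd₄ hn₄ k13
    (by rw [hB]; exact Dvd.intro_left (n * n * n * 3) (by ring)) (hcn w hn.le) (hcd w hn.le)
    (hzn w hn.le) (hzd w hn.le) hc hBL (by omega)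
  simpa only [hsol, ha0] using hfinal

/-! ### Running time and size of the input -/

/-- The number of steps that the program takes on inputs of length `n`. -/
def timeBound (n : ℕ) : ℕ := 76 * n ^ 2 + 51 * n + 80

theorem timeBound_isBigO :
    (fun n : ℕ => (timeBound n : ℝ)) =O[Filter.atTop]
      (fun n : ℕ => (n : ℝ) ^ 2 * Real.log n * Real.log (Real.log n)) := by
  have hlog : Filter.Tendsto (fun n : ℕ => Real.log n) Filter.atTop Filter.atTop :=
    Real.tendsto_log_atTop.comp tendsto_natCast_atTop_atTop
  have hloglog := Real.tendsto_log_atTop.comp hlog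
  -- Here `207 = 76 + 51 + 80`; both logarithmic factors are eventually at least `1`.
  refine Asymptotics.IsBigO.of_bound 207 ?_
  filter_upwards [hlog.eventually_ge_atTop 1, hloglog.eventually_ge_atTop 1,
    Filter.eventually_ge_atTop 1] with n h1 h2 h3
  have h3' : (1 : ℝ) ≤ n := by exact_mod_cast h3
  have h4 : (1 : ℝ) ≤ Real.log n * Real.log (Real.log n) := one_le_mul_of_one_le_of_one_le h1 h2
  have h5 : (n : ℝ) ^ 2 ≤ (n : ℝ) ^ 2 * Real.log n * Real.log (Real.log n) := by
    rw [mul_assoc]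
    exact le_mul_of_one_le_right (by positivity) h4
  rw [Real.norm_of_nonneg (by positivity), Real.norm_of_nonneg (le_trans (by positivity) h5)]
  refine le_trans ?_ (mul_le_mul_of_nonneg_left h5 (by norm_num))
  rw [timeBound]
  push_cast
  nlinarith

theorem memLE_inputMemory {w : EqWord} (hw : w ≠ []) :
    MemLE (memBound w.length) w.inputMemory := by
  have hn1 : 1 ≤ w.length := List.length_pos_iff.2 hw
  have h := small_le_memBound hn1
  have h' : w.length ≤ w.length ^ 4 := Nat.le_self_pow (by norm_num) _
  intro i
  rw [EqWord.inputMemory, abs_le]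
  split
  · omega
  · split
    · rw [List.getD_eq_getElem?_getD, List.getElem?_map]
      rcases w[(i - 1).toNat]? with _ | ⟨_ | _ | _, _ | _⟩ <;>
        simp [EqWord.letterCode, EqWord.expo] <;> omega
    · omega

end RandomAccess

open Classical in
theorem mainTheorem5 :
    (∃ (P : RandomAccess.Program) (time : ℕ → ℕ) (c : ℕ),
      (fun n : ℕ => (time n : ℝ)) =O[Filter.atTop]
        (fun n : ℕ => (n : ℝ) ^ 2 * Real.log n * Real.log (Real.log n)) ∧
      ∀ w : EqWord, w.sigmaX ≠ 0 →
        RandomAccess.HaltsWithin P w.inputMemory (time w.length) (if w.Solvable then 1 else 0) ∧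
        ∀ (k : ℕ) (i : ℤ),
          ((RandomAccess.run P w.inputMemory k).mem i).natAbs.size ≤ (w.length + 2) ^ c) ∧
    (∀ w : EqWord, w.sigmaX ≠ 0 →
      w.xw = w.sigmaX ∧
      (∀ s : FreeGroup ConstGen, w.IsSolution s →
        ((EqWord.constValue s).pos : ℚ) = -(w.tw : ℚ) / (w.xw : ℚ)) ∧
      (w.Solvable ↔
        ∃ δ : ℤ, (δ : ℚ) = -(w.tw : ℚ) / (w.xw : ℚ) ∧ w.den δ ∣ w.num δ)) := by
  refine ⟨⟨RandomAccess.compile 0 RandomAccess.equationCmds, RandomAccess.timeBound, 7,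
    RandomAccess.timeBound_isBigO, fun w hw => ?_⟩, fun w hw => ?_⟩
  · have hw' : w ≠ [] := by rintro rfl; exact hw rfl
    obtain ⟨h1, h2⟩ := (RandomAccess.leads_equation hw).haltsWithin
      (RandomAccess.memLE_inputMemory hw')
    refine ⟨h1, fun k i => ?_⟩
    have h := h2 k i
    rw [Int.abs_eq_natAbs] at h
    exact RandomAccess.size_memBound_le (List.length_pos_iff.2 hw') (by exact_mod_cast h)
  · have hx : w.xw ≠ 0 := by rwa [EqWord.xw_eq_sigmaX]
    refine ⟨EqWord.xw_eq_sigmaX w, fun s hs => EqWord.pos_of_isSolution hx hs, ?_⟩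
    rw [EqWord.solvable_iff]
    simp only [EqWord.eq_neg_tw_div_xw_iff hx]
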